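/- **Definitions.** Let $X$ be a complex Banach space and $T=(T_1,\dots,T_n)$ a tuple of commuting bounded linear operators on $X$. For $\lambda\in\mathbb C^n$ write $T-\lambda=(T_1-\lambda_1I,\dots,T_n-\lambda_nI)$, and let $$\hat T\colon X^n\to X,\quad \hat T(x_1,\dots,x_n)=\sum_{i}T_ix_i,\qquad \tilde T\colon X\to X^n,\quad \tilde T(x)=(T_1x,\dots,T_nx).$$ $N(\cdot)$ and $R(\cdot)$ denote null space and range, and "complemented" means having a closed direct complement (and being closed). Set - $\sigma_{\Phi_-}(T)=\{\lambda: R(T_1-\lambda_1)+\dots+R(T_n-\lambda_n)\text{ has infinite codimension in }X\}$, - $\sigma_\delta(T)=\{\lambda: R(T_1-\lambda_1)+\dots+R(T_n-\lambda_n)\ne X\}$, - $\sigma_{\Phi_+}(T)=\{\lambda: N(\widetilde{T-\lambda})\text{ is infinite-dimensional or }R(\widetilde{T-\lambda})\text{ is not closed}\}$, - $\sigma_\pi(T)=\{\lambda: N(\widetilde{T-\lambda})\neq 0\text{ or }R(\widetilde{T-\lambda})\text{ is not closed}\}$, - $\mathcal C_-(T)=\{\lambda: N(\widehat{T-\lambda})\text{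 is not complemented in }X^n\}$, $\ \mathcal C_+(T)=\{\lambda: R(\widetilde{T-\lambda})\text{ is not complemented in }X^n\}$, - $sp_\delta(T)=\sigma_\delta(T)\cup\mathcal C_-(T)$, $\ sp_{\delta e}(T)=\sigma_{\Phi_-}(T)\cup\mathcal C_-(T)$, $\ sp_\pi(T)=\sigma_\pi(T)\cup\mathcal C_+(T)$, $\ sp_{\pi e}(T)=\sigma_{\Phi_+}(T)\cup\mathcal C_+(T)$. An *operator ideal* $J$ between Banach spaces $X_2$ and $X_1$ is a linear subspace of $L(X_2,X_1)$ with a complete norm $\alpha$ such that, for all $x_1\in X_1$, $x_2'\in X_2'$, $A\in J$, $U\in L(X_1)$ and $V\in L(X_2)$: the rank one operator $x_1\otimes x_2'\colon x\mapsto x_2'(x)\,x_1$ lies in $J$ and $\alpha(x_1\otimes x_2')=\|x_1\|\,\|x_2'\|$; and $UAV\in J$ with $\alpha(UAV)\le\|U\|\,\alpha(A)\,\|V\|$. **Proposition 6.2.** Let $X_1$, $X_2$ be complex Banach spaces, $J$ an operator ideal between $X_2$ and $X_1$, and $S=(S_1,\dots,S_n)$, $T=(T_1,\dots,T_m)$ tuples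 of commuting bounded linear operators on $X_1$ and $X_2$ respectively. Let $(L_S,R_T)=(L_{S_1},\dots,L_{S_n},R_{T_1},\dots,R_{T_m})$ be the $(n+m)$-tuple of operators on the Banach space $(J,\alpha)$ given by $L_{S_i}A=S_iA$ and $R_{T_j}A=AT_j$. Then (i) $\ \sigma_{\Phi_-}(S)\times\sigma_\pi(T)\,\cup\,\sigma_\delta(S)\times\sigma_{\Phi_+}(T)\subseteq\sigma_{\Phi_-}(L_S,R_T)\subseteq sp_{\delta e}(L_S,R_T)\subseteq sp_{\delta e}(S)\times sp_\pi(T)\,\cup\,sp_\delta(S)\times sp_{\pi e}(T)$, (ii) $\ \sigma_{\Phi_+}(S)\times\sigma_\delta(T)\,\cup\,\sigma_\pi(S)\times\sigma_{\Phi_-}(T)\subseteq\sigma_{\Phi_+}(L_S,R_T)\subseteq sp_{\pi e}(L_S,R_T)\subseteq sp_{\pi e}(S)\times sp_\delta(T)\,\cup\,sp_\pi(S)\times sp_{\delta e}(T)$. If moreover $X_1$ and $X_2$ are Hilbert spaces, then all the inclusions in (i) and (ii) are equalities. -/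

import Mathlib

open Filter Topology

section JointSpectra

variable {X : Type*} [NormedAddCommGroup X] [NormedSpace ℂ X] {n m : ℕ}

/-- The translated tuple `T - a = (T₁ - a₁ I, …, Tₙ - aₙ I)`. -/
def tupleShift (T : Fin n → X →L[ℂ] X) (a : Fin n → ℂ) : Fin n → X →L[ℂ] X :=
  fun i => T i - a i • ContinuousLinearMap.id ℂ X

/-- The map `Xⁿ → X`, `(x₁, …, xₙ) ↦ T₁ x₁ + ⋯ + Tₙ xₙ`. -/
def tupleHat (T : Fin n → X →L[ℂ] X) : (Fin n → X) →L[ℂ] X :=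
  ∑ i, (T i).comp (ContinuousLinearMap.proj i)

/-- The map `X → Xⁿ`, `x ↦ (T₁ x, …, Tₙ x)`. -/
def tupleTilde (T : Fin n → X →L[ℂ] X) : X →L[ℂ] (Fin n → X) :=
  ContinuousLinearMap.pi T

/-- The linear subspace `R(T₁) + ⋯ + R(Tₙ)`. -/
def tupleRangeSum (T : Fin n → X →L[ℂ] X) : Submodule ℂ X :=
  ⨆ i, LinearMap.range (T i : X →ₗ[ℂ] X)

/-- `T` is lower semi-Fredholm: `R(T₁) + ⋯ + R(Tₙ)` has finite codimension. -/
def LowerSemiFredholm (T : Fin n → X →L[ℂ] X) : Prop :=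
  FiniteDimensional ℂ (X ⧸ tupleRangeSum T)

/-- `T` is upper semi-Fredholm: `x ↦ (T₁ x, …, Tₙ x)` has finite-dimensional null space and
closed range. -/
def UpperSemiFredholm (T : Fin n → X →L[ℂ] X) : Prop :=
  FiniteDimensional ℂ (LinearMap.ker (tupleTilde T : X →ₗ[ℂ] (Fin n → X))) ∧
    IsClosed (LinearMap.range (tupleTilde T : X →ₗ[ℂ] (Fin n → X)) : Set (Fin n → X))

/-- The lower semi-Fredholm joint spectrum. -/
def lowerFredholmSpectrum (T : Fin n → X →L[ℂ] X) : Set (Fin n → ℂ) :=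
  {a | ¬ LowerSemiFredholm (tupleShift T a)}

/-- The upper semi-Fredholm joint spectrum. -/
def upperFredholmSpectrum (T : Fin n → X →L[ℂ] X) : Set (Fin n → ℂ) :=
  {a | ¬ UpperSemiFredholm (tupleShift T a)}

/-- The defect spectrum: the codimension of `∑ R(Tᵢ - aᵢ)` is not zero. -/
def defectSpectrum (T : Fin n → X →L[ℂ] X) : Set (Fin n → ℂ) :=
  {a | tupleRangeSum (tupleShift T a) ≠ ⊤}

/-- The approximate point spectrum: `x ↦ ((Tᵢ - aᵢ) x)ᵢ` has a nonzero null space or a range that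
is not closed. -/
def approxPointSpectrum (T : Fin n → X →L[ℂ] X) : Set (Fin n → ℂ) :=
  {a | LinearMap.ker (tupleTilde (tupleShift T a) : X →ₗ[ℂ] (Fin n → X)) ≠ ⊥ ∨
    ¬ IsClosed (LinearMap.range (tupleTilde (tupleShift T a) : X →ₗ[ℂ] (Fin n → X)) :
      Set (Fin n → X))}

/-- The points where the null space of the map `Xⁿ → X` has no (topological) direct complement. -/
def kernelNotSplit (T : Fin n → X →L[ℂ] X) : Set (Fin n → ℂ) :=
  {a | ¬ (LinearMap.ker
    (tupleHat (tupleShift T a) : (Fin n → X) →ₗ[ℂ] X)).ClosedComplemented}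

/-- The points where the range of the map `X → Xⁿ` has no (topological) direct complement. -/
def rangeNotSplit (T : Fin n → X →L[ℂ] X) : Set (Fin n → ℂ) :=
  {a | ¬ (LinearMap.range
    (tupleTilde (tupleShift T a) : X →ₗ[ℂ] (Fin n → X))).ClosedComplemented}

/-- The split defect spectrum. -/
def splitDefectSpectrum (T : Fin n → X →L[ℂ] X) : Set (Fin n → ℂ) :=
  defectSpectrum T ∪ kernelNotSplit T

/-- The essential split defect spectrum. -/
def essSplitDefectSpectrum (T : Fin n → X →L[ℂ] X) : Set (Fin n → ℂ) :=
  lowerFredholmSpectrum T ∪ kernelNotSplit T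

/-- The split approximate point spectrum. -/
def splitApproxPointSpectrum (T : Fin n → X →L[ℂ] X) : Set (Fin n → ℂ) :=
  approxPointSpectrum T ∪ rangeNotSplit T

/-- The essential split approximate point spectrum. -/
def essSplitApproxPointSpectrum (T : Fin n → X →L[ℂ] X) : Set (Fin n → ℂ) :=
  upperFredholmSpectrum T ∪ rangeNotSplit T

/-- The product `A × B ⊆ ℂⁿ⁺ᵐ` of `A ⊆ ℂⁿ` and `B ⊆ ℂᵐ`. -/
def tupleProd (A : Set (Fin n → ℂ)) (B : Set (Fin m → ℂ)) : Set (Fin (n + m) → ℂ) :=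
  Set.image2 Fin.append A B

end JointSpectra

/-- The norm of the complex normed space `X` comes from an inner product (so a complete such `X` is
a Hilbert space). -/
def HasInnerProductNorm (X : Type*) [NormedAddCommGroup X] [inst : NormedSpace ℂ X] : Prop :=
  ∃ i : InnerProductSpace ℂ X, i.toNormedSpace = inst

/-- An operator ideal between the Banach spaces `X₂` and `X₁`: a linear subspace of `L(X₂, X₁)`
with a complete norm `α` of its own, containing the rank one operators `x₁ ⊗ u : x ↦ u(x) x₁`,
with `α (x₁ ⊗ u) = ‖x₁‖ ‖u‖`, and stable under `A ↦ S A T`, with `α (S A T) ≤ ‖S‖ α(A) ‖T‖`. -/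
structure OperatorIdeal (X₂ X₁ : Type*) [NormedAddCommGroup X₂] [NormedSpace ℂ X₂]
    [NormedAddCommGroup X₁] [NormedSpace ℂ X₁] where
  carrier : Submodule ℂ (X₂ →L[ℂ] X₁)
  α : Seminorm ℂ carrier
  eq_zero_of_α : ∀ A : carrier, α A = 0 → A = 0
  complete : ∀ u : ℕ → carrier,
    (∀ ε : ℝ, 0 < ε → ∃ N, ∀ k ≥ N, ∀ l ≥ N, α (u k - u l) < ε) →
      ∃ A : carrier, Tendsto (fun k => α (u k - A)) atTop (𝓝 0)
  rankOne_mem : ∀ (x : X₁) (u : X₂ →L[ℂ] ℂ), u.smulRight x ∈ carrier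
  α_rankOne : ∀ (x : X₁) (u : X₂ →L[ℂ] ℂ), α ⟨u.smulRight x, rankOne_mem x u⟩ = ‖x‖ * ‖u‖
  comp_mem : ∀ (S : X₁ →L[ℂ] X₁) (T : X₂ →L[ℂ] X₂) (A : carrier),
    S.comp ((A : X₂ →L[ℂ] X₁).comp T) ∈ carrier
  α_comp_le : ∀ (S : X₁ →L[ℂ] X₁) (T : X₂ →L[ℂ] X₂) (A : carrier),
    α ⟨S.comp ((A : X₂ →L[ℂ] X₁).comp T), comp_mem S T A⟩ ≤ ‖S‖ * α A * ‖T‖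

namespace OperatorIdeal

variable {X₂ X₁ : Type*} [NormedAddCommGroup X₂] [NormedSpace ℂ X₂]
  [NormedAddCommGroup X₁] [NormedSpace ℂ X₁]

/-- The operator ideal as a space of its own, to be normed by `α` (and not by the operator norm
that the subspace inherits). -/
def Space (J : OperatorIdeal X₂ X₁) : Type _ := J.carrier

noncomputable instance (J : OperatorIdeal X₂ X₁) : AddCommGroup J.Space :=
  inferInstanceAs (AddCommGroup J.carrier)

noncomputable instance (J : OperatorIdeal X₂ X₁) : Module ℂ J.Space :=
  inferInstanceAs (Module ℂ J.carrier)

noncomputable instance (J : OperatorIdeal X₂ X₁) : Norm J.Space := ⟨fun A => J.α A⟩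

theorem normCore (J : OperatorIdeal X₂ X₁) : NormedSpace.Core ℂ J.Space where
  norm_nonneg A := apply_nonneg J.α A
  norm_smul c A := map_smul_eq_mul J.α c A
  norm_triangle A B := map_add_le_add J.α A B
  norm_eq_zero_iff A := ⟨J.eq_zero_of_α A, by rintro rfl; exact map_zero J.α⟩

noncomputable instance (J : OperatorIdeal X₂ X₁) : NormedAddCommGroup J.Space :=
  NormedAddCommGroup.ofCore J.normCore

noncomputable instance (J : OperatorIdeal X₂ X₁) : NormedSpace ℂ J.Space :=
  NormedSpace.ofCore J.normCore

theorem norm_def (J : OperatorIdeal X₂ X₁) (A : J.Space) : ‖A‖ = J.α A := rfl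

instance (J : OperatorIdeal X₂ X₁) : CompleteSpace J.Space := by
  refine Metric.complete_of_cauchySeq_tendsto fun u hu => ?_
  obtain ⟨A, hA⟩ := J.complete u fun ε hε => by
    obtain ⟨N, hN⟩ := Metric.cauchySeq_iff.1 hu ε hε
    refine ⟨N, fun k hk l hl => ?_⟩
    have h := hN k hk l hl
    rw [dist_eq_norm] at h
    exact h
  exact ⟨A, tendsto_iff_norm_sub_tendsto_zero.2 hA⟩

/-- The two-sided multiplication `A ↦ S A T`, as a linear map of `J`. -/
noncomputable def mulLinear (J : OperatorIdeal X₂ X₁) (S : X₁ →L[ℂ] X₁) (T : X₂ →L[ℂ] X₂) :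
    J.Space →ₗ[ℂ] J.Space where
  toFun A := (⟨S.comp ((A : J.carrier).1.comp T), J.comp_mem S T A⟩ : J.carrier)
  map_add' A B := by
    apply Subtype.ext
    ext x
    exact map_add S ((A : J.carrier).1 (T x)) ((B : J.carrier).1 (T x))
  map_smul' c A := by
    apply Subtype.ext
    ext x
    exact map_smul S c ((A : J.carrier).1 (T x))

/-- The two-sided multiplication `A ↦ S A T`, as a bounded operator of `J`. -/
noncomputable def mul (J : OperatorIdeal X₂ X₁) (S : X₁ →L[ℂ] X₁) (T : X₂ →L[ℂ] X₂) :
    J.Space →L[ℂ] J.Space :=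
  (J.mulLinear S T).mkContinuous (‖S‖ * ‖T‖) fun A =>
    (J.α_comp_le S T A).trans_eq (mul_right_comm _ _ _)

/-- Left multiplication `A ↦ S A` on `J`. -/
noncomputable def leftMul (J : OperatorIdeal X₂ X₁) (S : X₁ →L[ℂ] X₁) : J.Space →L[ℂ] J.Space :=
  J.mul S (ContinuousLinearMap.id ℂ X₂)

/-- Right multiplication `A ↦ A T` on `J`. -/
noncomputable def rightMul (J : OperatorIdeal X₂ X₁) (T : X₂ →L[ℂ] X₂) : J.Space →L[ℂ] J.Space :=
  J.mul (ContinuousLinearMap.id ℂ X₁) T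

/-- The tuple `(L_S, R_T) = (L_{S₁}, …, L_{Sₙ}, R_{T₁}, …, R_{Tₘ})` of operators on `J`. -/
noncomputable def mulTuple {n m : ℕ} (J : OperatorIdeal X₂ X₁) (S : Fin n → X₁ →L[ℂ] X₁)
    (T : Fin m → X₂ →L[ℂ] X₂) : Fin (n + m) → J.Space →L[ℂ] J.Space :=
  Fin.append (fun i => J.leftMul (S i)) (fun j => J.rightMul (T j))

end OperatorIdeal

/-!
Write `Ŝ : X₁ⁿ → X₁`, `(xᵢ) ↦ ∑ Sᵢ xᵢ` and `S̃ : X₁ → X₁ⁿ`, `x ↦ (Sᵢ x)` for the row and the column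
of a tuple `S`. Since `(L_S, R_T) - (a, b) = (L_{S - a}, R_{T - b})`, every inclusion is a statement
about the point `0` for arbitrary tuples `S` and `T`.

*Lower inclusions.* They come from testing on rank one operators `y ⊗ u`, whose ideal norm is
`‖y‖ ‖u‖`. A row is onto unless its adjoint has approximate null vectors
(`surjective_of_dual_bounded_below`), and a column is injective with closed range unless it has such
vectors itself. Fixing an approximate null vector of one factor makes the contribution of that
factor negligible, and the semi-Fredholm property of `(L_S, R_T)` passes to the other factor. To
make this work in the presence of finite-dimensional defects, semi-Fredholm properties are
rephrased as estimates up to finite-rank terms (`exists_bounded_decomposition`,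
`upperSemiFredholm_of_bound`, `finiteDimensional_quotient_of_dual_bound`).

*Upper inclusions.* A row has finite-codimensional range and complemented null space exactly if it
has a right inverse modulo finite rank, and a column has finite-dimensional null space and
complemented range exactly if it has a left inverse modulo finite rank (`split_lowerFredholm_iff`,
`split_upperFredholm_iff`); both follow from the calculus of inner inverses `f B f = f`. If
`E = 1 - Ŝ K` and `F = 1 - P T̃`, then `A ↦ (Kᵢ A, E A Pⱼ)` is a right inverse of the row of
`(L_S, R_T)` up to `A ↦ E A F`, which has finite rank if `E` and `F` have, and vanishes if one of
them does. The column is treated in the same way.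

*Hilbert spaces.* Closed subspaces are complemented there, so the outer terms of both chains of
inclusions coincide.
-/

/-! ### Bounded below and surjective operators -/

section BanachSpaces

variable {E F : Type*} [NormedAddCommGroup E] [NormedSpace ℂ E] [NormedAddCommGroup F]
  [NormedSpace ℂ F]

/-- The successive approximation step of the open mapping theorem: solving `f x = y` up to half of
`‖y‖`, with a linear bound on `x`, is enough for solving it exactly. -/
theorem surjective_of_approx_preimage [CompleteSpace E] (f : E →L[ℂ] F) (C : ℝ)
    (h : ∀ y, ∃ x, ‖y - f x‖ ≤ 1 / 2 * ‖y‖ ∧ ‖x‖ ≤ C * ‖y‖) : Function.Surjective f := by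
  choose g hg using h
  intro y
  -- `r y` is the part of `y` left over by the approximate preimage `g y`
  let r : F → F := fun y => y - f (g y)
  have hr : ∀ k : ℕ, ‖r^[k] y‖ ≤ (1 / 2) ^ k * ‖y‖ := by
    intro k
    induction k with
    | zero => simp
    | succ k ih =>
      rw [Function.iterate_succ_apply']
      refine (hg _).1.trans ?_
      rw [pow_succ', mul_assoc]
      gcongr
  have hC : ∀ z, ‖g z‖ ≤ max C 0 * ‖z‖ := fun z =>
    (hg z).2.trans (by gcongr; exact le_max_left _ _)
  have hs : Summable fun k => g (r^[k] y) := by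
    refine Summable.of_norm_bounded
      ((summable_geometric_of_lt_one (r := (1 / 2 : ℝ)) (by norm_num) (by norm_num)).mul_right
        (max C 0 * ‖y‖)) fun k => (hC _).trans ?_
    calc max C 0 * ‖r^[k] y‖ ≤ max C 0 * ((1 / 2) ^ k * ‖y‖) := by gcongr; exact hr k
      _ = (1 / 2) ^ k * (max C 0 * ‖y‖) := by ring
  have hsum : ∀ k : ℕ, f (∑ i ∈ Finset.range k, g (r^[i] y)) = y - r^[k] y := by
    intro k
    induction k with
    | zero => simp
    | succ k ih =>
      rw [Finset.sum_range_succ, map_add, ih, Function.iterate_succ_apply']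
      simp only [r]
      abel
  refine ⟨∑' k, g (r^[k] y), ?_⟩
  have h₁ := (f.continuous.tendsto _).comp hs.hasSum.tendsto_sum_nat
  have h₂ : Tendsto (fun k => r^[k] y) atTop (𝓝 0) := by
    refine squeeze_zero_norm hr ?_
    simpa using (tendsto_pow_atTop_nhds_zero_of_lt_one (r := (1 / 2 : ℝ)) (by norm_num)
      (by norm_num)).mul_const ‖y‖
  refine tendsto_nhds_unique h₁ ?_
  simpa [Function.comp_def, hsum] using h₂.const_sub y

/-- If the adjoint of `f` is bounded below, then `f` is onto: by Hahn–Banach separation, the closure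
of the image of a ball contains the unit ball. -/
theorem surjective_of_dual_bounded_below [CompleteSpace E] (f : E →L[ℂ] F) {c : ℝ} (hc : 0 < c)
    (h : ∀ v : F →L[ℂ] ℂ, c * ‖v‖ ≤ ‖v.comp f‖) : Function.Surjective f := by
  have key : ∀ y : F, ‖y‖ ≤ 1 → y ∈ closure (f '' Metric.closedBall 0 c⁻¹) := by
    intro y hy
    by_contra hmem
    have hconv : Convex ℝ (closure (f '' Metric.closedBall 0 c⁻¹)) :=
      ((convex_closedBall (0 : E) c⁻¹).is_linear_image
        (f.restrictScalars ℝ).toLinearMap.isLinear).closure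
    obtain ⟨v, s, hv, hvy⟩ := RCLike.geometric_hahn_banach_closed_point (𝕜 := ℂ) hconv
      isClosed_closure hmem
    have hs0 : 0 < s := by
      simpa using hv 0 (subset_closure ⟨0, by simp [hc.le], map_zero f⟩)
    -- the ball is balanced, so the bound on real parts is a bound on absolute values
    have hball : ∀ x : E, ‖x‖ ≤ c⁻¹ → ‖v (f x)‖ ≤ s := by
      intro x hx
      obtain ⟨θ, hθ, hθx⟩ := RCLike.exists_norm_mul_eq_self (v (f x))
      have := hv (f (θ⁻¹ • x)) (subset_closure ⟨θ⁻¹ • x, by simp [norm_smul, hθ, hx], rfl⟩)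
      have hθ0 : θ ≠ 0 := by rintro rfl; simp at hθ
      have e : v (f (θ⁻¹ • x)) = (‖v (f x)‖ : ℂ) := by
        rw [map_smul, map_smul, smul_eq_mul, inv_mul_eq_iff_eq_mul₀ hθ0]
        exact hθx.symm
      rw [e] at this
      simpa using this.le
    have h1 : ‖v.comp f‖ ≤ s * c := by
      refine ContinuousLinearMap.opNorm_le_bound _ (by positivity) fun x => ?_
      rcases eq_or_ne x 0 with rfl | hx
      · simp
      have hx' : 0 < ‖x‖ := norm_pos_iff.2 hx
      have := hball (((c⁻¹ * ‖x‖⁻¹ : ℝ) : ℂ) • x) (by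
        rw [norm_smul, Complex.norm_real, Real.norm_of_nonneg (by positivity), mul_assoc,
          inv_mul_cancel₀ hx'.ne', mul_one])
      rw [map_smul, map_smul, norm_smul, Complex.norm_real, Real.norm_of_nonneg (by positivity),
        ← mul_inv, inv_mul_le_iff₀ (by positivity)] at this
      calc ‖v (f x)‖ ≤ c * ‖x‖ * s := this
        _ = s * c * ‖x‖ := by ring
    have h2 : ‖v‖ ≤ s := by
      have := (h v).trans h1
      rw [mul_comm] at this
      exact le_of_mul_le_mul_right this hc
    have h3 : RCLike.re (v y) ≤ ‖v‖ :=
      (RCLike.re_le_norm _).trans ((v.le_opNorm y).trans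
        (mul_le_of_le_one_right (norm_nonneg _) hy))
    linarith
  refine surjective_of_approx_preimage f c⁻¹ fun y => ?_
  rcases eq_or_ne y 0 with rfl | hy
  · exact ⟨0, by simp⟩
  have hy' : 0 < ‖y‖ := norm_pos_iff.2 hy
  obtain ⟨_, ⟨x, hx, rfl⟩, hxy⟩ := Metric.mem_closure_iff.1 (key (((‖y‖⁻¹ : ℝ) : ℂ) • y) (by
    rw [norm_smul, Complex.norm_real, Real.norm_of_nonneg (by positivity),
      inv_mul_cancel₀ hy'.ne'])) (1 / 2) (by norm_num)
  refine ⟨(‖y‖ : ℂ) • x, ?_, ?_⟩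
  · have e : y - f ((‖y‖ : ℂ) • x) = (‖y‖ : ℂ) • (((‖y‖⁻¹ : ℝ) : ℂ) • y - f x) := by
      rw [map_smul, smul_sub, smul_smul, ← Complex.ofReal_mul, mul_inv_cancel₀ hy'.ne']
      simp
    rw [e, norm_smul, Complex.norm_real, norm_norm, mul_comm]
    rw [dist_eq_norm] at hxy
    gcongr
  · rw [norm_smul, Complex.norm_real, norm_norm, mul_comm]
    gcongr
    simpa using hx

/-- An operator that is not onto has an adjoint with approximate null vectors. -/
theorem exists_dual_comp_norm_le [CompleteSpace E] (f : E →L[ℂ] F)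
    (h : ¬ Function.Surjective f) {ε : ℝ} (hε : 0 < ε) :
    ∃ v : F →L[ℂ] ℂ, ‖v‖ = 1 ∧ ‖v.comp f‖ ≤ ε := by
  have h' : ∃ v : F →L[ℂ] ℂ, ‖v.comp f‖ < ε * ‖v‖ := by
    by_contra! h'
    exact h (surjective_of_dual_bounded_below f hε h')
  obtain ⟨v, hv⟩ := h'
  have hv0 : 0 < ‖v‖ := pos_of_mul_pos_right ((norm_nonneg _).trans_lt hv) hε.le
  refine ⟨((‖v‖⁻¹ : ℝ) : ℂ) • v, ?_, ?_⟩
  · rw [norm_smul, Complex.norm_real, norm_inv, norm_norm, inv_mul_cancel₀ hv0.ne']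
  · rw [ContinuousLinearMap.smul_comp, norm_smul, Complex.norm_real, norm_inv, norm_norm,
      inv_mul_le_iff₀ hv0, mul_comm]
    exact hv.le

/-- An operator that is not injective, or whose range is not closed, has approximate null vectors. -/
theorem exists_norm_apply_le [CompleteSpace E] (f : E →L[ℂ] F)
    (h : LinearMap.ker (f : E →ₗ[ℂ] F) ≠ ⊥ ∨
      ¬ IsClosed (LinearMap.range (f : E →ₗ[ℂ] F) : Set F)) {ε : ℝ} (hε : 0 < ε) :
    ∃ x, ‖x‖ = 1 ∧ ‖f x‖ ≤ ε := by
  have h' : ∃ x, ‖f x‖ < ε * ‖x‖ := by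
    by_contra! h'
    have ha : AntilipschitzWith (Real.toNNReal ε⁻¹) f :=
      AddMonoidHomClass.antilipschitz_of_bound f fun x => by
        rw [Real.coe_toNNReal _ (by positivity), ← div_eq_inv_mul, le_div_iff₀' hε]
        exact h' x
    rcases h with h | h
    · exact h (LinearMap.ker_eq_bot.2 ha.injective)
    · exact h (ha.isClosed_range f.uniformContinuous)
  obtain ⟨x, hx⟩ := h'
  have hx0 : 0 < ‖x‖ := pos_of_mul_pos_right ((norm_nonneg _).trans_lt hx) hε.le
  refine ⟨((‖x‖⁻¹ : ℝ) : ℂ) • x, ?_, ?_⟩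
  · rw [norm_smul, Complex.norm_real, norm_inv, norm_norm, inv_mul_cancel₀ hx0.ne']
  · rw [map_smul, norm_smul, Complex.norm_real, norm_inv, norm_norm, inv_mul_le_iff₀ hx0, mul_comm]
    exact hx.le

theorem exists_bound_below [CompleteSpace E] [CompleteSpace F] (f : E →L[ℂ] F)
    (hi : Function.Injective f) (hf : IsClosed (Set.range f)) :
    ∃ c > 0, ∀ x, c * ‖x‖ ≤ ‖f x‖ := by
  obtain ⟨K, hK⟩ := f.antilipschitz_of_injective_of_isClosed_range hi hf
  refine ⟨((K : ℝ) + 1)⁻¹, by positivity, fun x => ?_⟩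
  rw [inv_mul_le_iff₀ (by positivity)]
  have := hK.le_mul_dist x 0
  rw [dist_zero_right, map_zero, dist_zero_right] at this
  nlinarith [norm_nonneg (f x)]

/-! ### Semi-Fredholm operators -/

theorem finiteDimensional_quotient_of_coprod_surjective {G : Type*} [AddCommGroup G] [Module ℂ G]
    [FiniteDimensional ℂ G] (f : E →L[ℂ] F) (g : G →ₗ[ℂ] F) (h : ∀ y, ∃ a x, y = g a + f x) :
    FiniteDimensional ℂ (F ⧸ LinearMap.range (f : E →ₗ[ℂ] F)) := by
  refine Module.Finite.of_surjective ((LinearMap.range (f : E →ₗ[ℂ] F)).mkQ ∘ₗ g) fun q => ?_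
  obtain ⟨y, rfl⟩ := Submodule.mkQ_surjective _ q
  obtain ⟨a, x, rfl⟩ := h y
  refine ⟨a, ?_⟩
  simp only [LinearMap.comp_apply, Submodule.mkQ_apply]
  rw [Submodule.Quotient.eq]
  exact ⟨-x, by simp⟩

theorem exists_complement_of_finiteDimensional_quotient [CompleteSpace E] [CompleteSpace F]
    (f : E →L[ℂ] F) (h : FiniteDimensional ℂ (F ⧸ LinearMap.range (f : E →ₗ[ℂ] F))) :
    ∃ G : Submodule ℂ F, FiniteDimensional ℂ G ∧ IsCompl (LinearMap.range (f : E →ₗ[ℂ] F)) G ∧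
      Function.Surjective (G.subtypeL.coprod f) := by
  obtain ⟨G, hG⟩ := (LinearMap.range (f : E →ₗ[ℂ] F)).exists_isCompl
  refine ⟨G, (Submodule.quotientEquivOfIsCompl _ G hG).finiteDimensional, hG, fun y => ?_⟩
  have hy : y ∈ LinearMap.range (f : E →ₗ[ℂ] F) ⊔ G := by rw [hG.sup_eq_top]; trivial
  obtain ⟨_, ⟨x, rfl⟩, a, ha, rfl⟩ := Submodule.mem_sup.1 hy
  exact ⟨(⟨a, ha⟩, x), by simp [add_comm]⟩

/-- Quantitative form of finite codimension: modulo finitely many parameters, `f x = y` can be solved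
with a linear bound. -/
theorem exists_bounded_decomposition [CompleteSpace E] [CompleteSpace F] (f : E →L[ℂ] F)
    (h : FiniteDimensional ℂ (F ⧸ LinearMap.range (f : E →ₗ[ℂ] F))) :
    ∃ (k : ℕ) (i : (Fin k → ℂ) →L[ℂ] F), ∃ C > 0, ∀ y, ∃ (a : Fin k → ℂ) (x : E),
      y = i a + f x ∧ ‖a‖ ≤ C * ‖y‖ ∧ ‖x‖ ≤ C * ‖y‖ := by
  obtain ⟨G, hG, -, hs⟩ := exists_complement_of_finiteDimensional_quotient f h
  let e := (Module.finBasis ℂ G).equivFun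
  let i : (Fin (Module.finrank ℂ G) → ℂ) →L[ℂ] F :=
    LinearMap.toContinuousLinearMap (G.subtype ∘ₗ e.symm.toLinearMap)
  have hs' : Function.Surjective (i.coprod f) := fun y => by
    obtain ⟨⟨a, x⟩, rfl⟩ := hs y
    exact ⟨(e a, x), by simp [i]⟩
  obtain ⟨C, hC, hb⟩ := ContinuousLinearMap.exists_preimage_norm_le _ hs'
  refine ⟨_, i, C, hC, fun y => ?_⟩
  obtain ⟨⟨a, x⟩, hax, hn⟩ := hb y
  exact ⟨a, x, by simpa using hax.symm, (norm_fst_le (a, x)).trans hn,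
    (norm_snd_le (a, x)).trans hn⟩

theorem isClosed_range_of_finiteDimensional_quotient [CompleteSpace E] [CompleteSpace F]
    (f : E →L[ℂ] F) (h : FiniteDimensional ℂ (F ⧸ LinearMap.range (f : E →ₗ[ℂ] F))) :
    IsClosed (LinearMap.range (f : E →ₗ[ℂ] F) : Set F) := by
  obtain ⟨G, hG, hc, hs⟩ := exists_complement_of_finiteDimensional_quotient f h
  have := FiniteDimensional.complete ℂ G
  -- the pullback of the range along the open map `G × E → F` is `{0} × E`
  rw [← (ContinuousLinearMap.isQuotientMap _ hs).isClosed_preimage]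
  suffices e : (G.subtypeL.coprod f) ⁻¹' (LinearMap.range (f : E →ₗ[ℂ] F) : Set F) =
      Prod.fst ⁻¹' {(0 : G)} by
    rw [e]
    exact isClosed_singleton.preimage continuous_fst
  ext ⟨a, x⟩
  have hx : f x ∈ LinearMap.range (f : E →ₗ[ℂ] F) := ⟨x, rfl⟩
  simp only [Set.mem_preimage, ContinuousLinearMap.coprod_apply, Submodule.subtypeL_apply,
    SetLike.mem_coe, Submodule.add_mem_iff_left _ hx, Set.mem_singleton_iff]
  refine ⟨fun ha => Subtype.ext ?_, fun ha => by simp [ha]⟩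
  exact Submodule.disjoint_def.1 hc.disjoint _ ha a.2

/-- An operator that is bounded below up to a finite-rank term `g` is upper semi-Fredholm. -/
theorem upperSemiFredholm_of_bound [CompleteSpace E] {W : Type*} [NormedAddCommGroup W]
    [NormedSpace ℂ W] [FiniteDimensional ℂ W] (f : E →L[ℂ] F) (g : E →L[ℂ] W) {c : ℝ} (hc : 0 < c)
    (h : ∀ x, c * ‖x‖ ≤ ‖f x‖ + ‖g x‖) :
    FiniteDimensional ℂ (LinearMap.ker (f : E →ₗ[ℂ] F)) ∧
      IsClosed (LinearMap.range (f : E →ₗ[ℂ] F) : Set F) := by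
  constructor
  · refine FiniteDimensional.of_injective
      ((g : E →ₗ[ℂ] W) ∘ₗ (LinearMap.ker (f : E →ₗ[ℂ] F)).subtype) ?_
    refine (injective_iff_map_eq_zero _).2 fun x hx => ?_
    have h0 := h x
    have hfx : f x = 0 := x.2
    have hgx : g x = 0 := hx
    rw [hfx, hgx, norm_zero, norm_zero, add_zero] at h0
    have := norm_nonneg (x : E)
    exact Subtype.ext (norm_eq_zero.1 (by nlinarith))
  · have hfd : (LinearMap.ker (g : E →ₗ[ℂ] W)).CoFG :=
      (g : E →ₗ[ℂ] W).quotKerEquivRange.symm.finiteDimensional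
    refine LinearMap.isClosed_range_of_isClosed_map_of_finiteDimensional_quotient
      (𝕜 := ℂ) (s := LinearMap.ker (g : E →ₗ[ℂ] W)) ?_
    have : CompleteSpace (LinearMap.ker (g : E →ₗ[ℂ] W)) :=
      g.isClosed_ker.completeSpace_coe
    have ha : AntilipschitzWith (Real.toNNReal c⁻¹)
        (f.comp (LinearMap.ker (g : E →ₗ[ℂ] W)).subtypeL) :=
      AddMonoidHomClass.antilipschitz_of_bound _ fun x => by
        rw [Real.coe_toNNReal _ (by positivity), ← div_eq_inv_mul, le_div_iff₀' hc]
        have h0 := h x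
        have hgx : g x = 0 := x.2
        simpa [hgx] using h0
    convert ha.isClosed_range (ContinuousLinearMap.uniformContinuous _) using 1
    ext y
    simp

/-- Converse of `upperSemiFredholm_of_bound`: the finite-rank term can be a projection onto the null
space. -/
theorem exists_bound_of_upperSemiFredholm [CompleteSpace E] [CompleteSpace F] (f : E →L[ℂ] F)
    (hk : FiniteDimensional ℂ (LinearMap.ker (f : E →ₗ[ℂ] F)))
    (hr : IsClosed (LinearMap.range (f : E →ₗ[ℂ] F) : Set F)) :
    ∃ g : E →L[ℂ] LinearMap.ker (f : E →ₗ[ℂ] F), ∃ c > 0, ∀ x, c * ‖x‖ ≤ ‖f x‖ + ‖g x‖ := by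
  obtain ⟨g, hg⟩ := Submodule.ClosedComplemented.of_finiteDimensional
    (LinearMap.ker (f : E →ₗ[ℂ] F))
  have := FiniteDimensional.complete ℂ (LinearMap.ker (f : E →ₗ[ℂ] F))
  have hi : Function.Injective (f.prod g) := by
    refine (injective_iff_map_eq_zero _).2 fun x hx => ?_
    have hx' : f x = 0 ∧ g x = 0 := by simpa using hx
    have := hg ⟨x, hx'.1⟩
    exact (congrArg Subtype.val (this.symm.trans hx'.2))
  have hrange : Set.range (f.prod g) =
      (LinearMap.range (f : E →ₗ[ℂ] F) : Set F) ×ˢ Set.univ := by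
    ext ⟨y, k⟩
    constructor
    · rintro ⟨x, hx⟩
      exact ⟨⟨x, congrArg Prod.fst hx⟩, trivial⟩
    · rintro ⟨⟨x, hx⟩, -⟩
      have hx' : f x = y := hx
      refine ⟨x - g x + k, ?_⟩
      have h1 : f (g x : E) = 0 := (g x).2
      have h2 : f (k : E) = 0 := k.2
      simp [h1, h2, hx', hg]
  obtain ⟨c, hc, h⟩ := exists_bound_below (f.prod g) hi (hrange ▸ hr.prod isClosed_univ)
  refine ⟨g, c, hc, fun x => (h x).trans ?_⟩
  rw [ContinuousLinearMap.prod_apply, Prod.norm_def]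
  exact max_le (le_add_of_nonneg_right (norm_nonneg _)) (le_add_of_nonneg_left (norm_nonneg _))

/-- Some finite-dimensional subspace of `F` separates the elements of a given finite-dimensional space
of functionals. -/
theorem exists_separating_submodule (K : Submodule ℂ (F →L[ℂ] ℂ)) [FiniteDimensional ℂ K] :
    ∃ G : Submodule ℂ F, FiniteDimensional ℂ G ∧ ∀ u ∈ K, (∀ y ∈ G, u y = 0) → u = 0 := by
  let K' : Submodule ℂ (Module.Dual ℂ F) := K.map (ContinuousLinearMap.coeLM ℂ)
  have hq : FiniteDimensional ℂ (F ⧸ K'.dualCoannihilator) :=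
    Subspace.finiteDimensional_quot_dualCoannihilator_iff.2 inferInstance
  obtain ⟨G, hG⟩ := K'.dualCoannihilator.exists_isCompl
  refine ⟨G, (Submodule.quotientEquivOfIsCompl _ G hG).finiteDimensional, fun u hu h => ?_⟩
  ext y
  have hy : y ∈ K'.dualCoannihilator ⊔ G := by rw [hG.sup_eq_top]; trivial
  obtain ⟨a, ha, b, hb, rfl⟩ := Submodule.mem_sup.1 hy
  have h1 : u a = 0 := (Submodule.mem_dualCoannihilator a).1 ha _ (Submodule.mem_map_of_mem hu)
  simp [h1, h b hb]

/-- If `f` is bounded below up to a finite-rank term, and `r` is injective on the null space of `f`,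
then the pair `(f, r)` is bounded below. -/
theorem exists_bound_below_max [CompleteSpace E] [CompleteSpace F] {G W : Type*}
    [NormedAddCommGroup G] [NormedSpace ℂ G] [CompleteSpace G] [NormedAddCommGroup W]
    [NormedSpace ℂ W] [FiniteDimensional ℂ W] (f : E →L[ℂ] F) (r : E →L[ℂ] G) (g : E →L[ℂ] W)
    {c : ℝ} (hc : 0 < c) (h : ∀ x, c * ‖x‖ ≤ ‖f x‖ + ‖g x‖)
    (hi : ∀ x, f x = 0 → r x = 0 → x = 0) :
    ∃ d > 0, ∀ x, d * ‖x‖ ≤ max ‖f x‖ ‖r x‖ := by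
  have hprod : ∀ x, c * ‖x‖ ≤ ‖(f.prod r) x‖ + ‖g x‖ := fun x =>
    (h x).trans (add_le_add (norm_fst_le (f x, r x)) le_rfl)
  obtain ⟨-, hcl⟩ := upperSemiFredholm_of_bound (f.prod r) g hc hprod
  obtain ⟨d, hd, hb⟩ := exists_bound_below (f.prod r)
    ((injective_iff_map_eq_zero _).2 fun x hx =>
      hi x (congrArg Prod.fst hx) (congrArg Prod.snd hx)) hcl
  exact ⟨d, hd, hb⟩

theorem finiteDimensional_quotient_of_separating [CompleteSpace E] {G W : Type*}
    [NormedAddCommGroup G] [NormedSpace ℂ G] [FiniteDimensional ℂ G]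
    [NormedAddCommGroup W] [NormedSpace ℂ W] [FiniteDimensional ℂ W] (f : E →L[ℂ] F)
    (i : G →L[ℂ] F) (g : (F →L[ℂ] ℂ) →L[ℂ] W) {c : ℝ} (hc : 0 < c)
    (h : ∀ u, c * ‖u‖ ≤ ‖u.comp f‖ + ‖g u‖)
    (hi : ∀ u : F →L[ℂ] ℂ, u.comp f = 0 → u.comp i = 0 → u = 0) :
    FiniteDimensional ℂ (F ⧸ LinearMap.range (f : E →ₗ[ℂ] F)) := by
  have := FiniteDimensional.complete ℂ G
  obtain ⟨d, hd, hb⟩ := exists_bound_below_max ((ContinuousLinearMap.compL ℂ E F ℂ).flip f)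
    ((ContinuousLinearMap.compL ℂ G F ℂ).flip i) g hc h hi
  have hs : Function.Surjective (i.coprod f) := by
    refine surjective_of_dual_bounded_below _ hd fun u => (hb u).trans ?_
    refine max_le ?_ ?_ <;>
      refine ContinuousLinearMap.opNorm_le_bound _ (norm_nonneg _) fun x => ?_
    · have := (u.comp (i.coprod f)).le_opNorm (0, x)
      simpa using this
    · have := (u.comp (i.coprod f)).le_opNorm (x, 0)
      simpa using this
  refine finiteDimensional_quotient_of_coprod_surjective f (i : G →ₗ[ℂ] F) fun y => ?_
  obtain ⟨⟨a, x⟩, hax⟩ := hs y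
  exact ⟨a, x, by simpa using hax.symm⟩

/-- If the adjoint of `f` is bounded below up to a finite-rank term, then the range of `f` has finite
codimension. Its closedness needs no separate argument: joining to `f` the inclusion of a
finite-dimensional subspace that separates the null space of the adjoint gives an operator that is
onto. -/
theorem finiteDimensional_quotient_of_dual_bound [CompleteSpace E] {W : Type*}
    [NormedAddCommGroup W] [NormedSpace ℂ W] [FiniteDimensional ℂ W] (f : E →L[ℂ] F)
    (g : (F →L[ℂ] ℂ) →L[ℂ] W) {c : ℝ} (hc : 0 < c) (h : ∀ u, c * ‖u‖ ≤ ‖u.comp f‖ + ‖g u‖) :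
    FiniteDimensional ℂ (F ⧸ LinearMap.range (f : E →ₗ[ℂ] F)) := by
  let f' : (F →L[ℂ] ℂ) →L[ℂ] (E →L[ℂ] ℂ) := (ContinuousLinearMap.compL ℂ E F ℂ).flip f
  obtain ⟨hk, -⟩ := upperSemiFredholm_of_bound f' g hc h
  obtain ⟨G, hG, hsep⟩ := exists_separating_submodule
    (LinearMap.ker (f' : (F →L[ℂ] ℂ) →ₗ[ℂ] (E →L[ℂ] ℂ)))
  exact finiteDimensional_quotient_of_separating f G.subtypeL g hc h fun u hu hr =>
    hsep u hu fun y hy => congrArg (fun w : G →L[ℂ] ℂ => w ⟨y, hy⟩) hr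

/-! ### Inner inverses -/

theorem exists_innerInverse_of_closedComplemented [CompleteSpace E] [CompleteSpace F]
    (f : E →L[ℂ] F) (hk : (LinearMap.ker (f : E →ₗ[ℂ] F)).ClosedComplemented)
    (hr : (LinearMap.range (f : E →ₗ[ℂ] F)).ClosedComplemented) :
    ∃ B : F →L[ℂ] E, ∀ x, f (B (f x)) = f x := by
  obtain ⟨q, hq⟩ := hk
  have hrc := hr.isClosed
  obtain ⟨p, hp⟩ := hr
  have : CompleteSpace (LinearMap.ker (f : E →ₗ[ℂ] F)) := f.isClosed_ker.completeSpace_coe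
  have : CompleteSpace (LinearMap.range (f : E →ₗ[ℂ] F)) := hrc.completeSpace_coe
  have hs : Function.Surjective (f.rangeRestrict) := by
    rintro ⟨_, x, rfl⟩
    exact ⟨x, rfl⟩
  -- `x ↦ (q x, f x)` is an isomorphism of `E` with the product of null space and range
  let Φ : E →L[ℂ] LinearMap.ker (f : E →ₗ[ℂ] F) × LinearMap.range (f : E →ₗ[ℂ] F) :=
    q.prod f.rangeRestrict
  have hi : LinearMap.ker Φ.toLinearMap = ⊥ := by
    refine LinearMap.ker_eq_bot'.2 fun x hx => ?_
    have h1 : q x = 0 := congrArg Prod.fst hx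
    have h2 : f x = 0 := congrArg (fun z => (z.2 : F)) hx
    have := hq ⟨x, h2⟩
    exact (congrArg Subtype.val (this.symm.trans h1))
  have hΦ : LinearMap.range Φ.toLinearMap = ⊤ := by
    refine LinearMap.range_eq_top.2 ?_
    rintro ⟨k, y⟩
    obtain ⟨x, rfl⟩ := hs y
    refine ⟨x - q x + k, Prod.ext ?_ (Subtype.ext ?_)⟩
    · simp [Φ, hq]
    · simp [Φ]
  let e := ContinuousLinearEquiv.ofBijective Φ hi hΦ
  refine ⟨e.symm.toContinuousLinearMap.comp ((ContinuousLinearMap.inr ℂ _ _).comp p), fun x => ?_⟩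
  have h1 : Φ (e.symm (0, p (f x))) = (0, p (f x)) :=
    ContinuousLinearEquiv.ofBijective_apply_symm_apply Φ hi hΦ _
  have h2 : f (e.symm (0, p (f x))) = p (f x) := congrArg (fun z => (z.2 : F)) h1
  have h3 : p (f x) = ⟨f x, x, rfl⟩ := hp ⟨f x, x, rfl⟩
  simpa [h3] using h2

theorem exists_innerInverse_of_finiteDimensional_range (f : E →L[ℂ] F)
    (h : FiniteDimensional ℂ (LinearMap.range (f : E →ₗ[ℂ] F))) :
    ∃ B : F →L[ℂ] E, ∀ x, f (B (f x)) = f x := by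
  obtain ⟨p, hp⟩ := Submodule.ClosedComplemented.of_finiteDimensional
    (LinearMap.range (f : E →ₗ[ℂ] F))
  obtain ⟨s, hs⟩ := (f : E →ₗ[ℂ] F).rangeRestrict.exists_rightInverse_of_surjective
    (f : E →ₗ[ℂ] F).range_rangeRestrict
  refine ⟨(LinearMap.toContinuousLinearMap s).comp p, fun x => ?_⟩
  have h1 : p (f x) = ⟨f x, x, rfl⟩ := hp ⟨f x, x, rfl⟩
  have h2 := congrArg Subtype.val (LinearMap.congr_fun hs ⟨f x, x, rfl⟩)
  simpa [h1] using h2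

/-- Inner inverses may be sought modulo finite rank: if `D` is an inner inverse of `f - f P f`, then
`P + (1 - P f) D (1 - f P)` is one of `f`. -/
theorem exists_innerInverse_of_sub (f : E →L[ℂ] F) (P : F →L[ℂ] E)
    (h : FiniteDimensional ℂ (LinearMap.range ((f - f.comp (P.comp f) : E →L[ℂ] F) : E →ₗ[ℂ] F))) :
    ∃ B : F →L[ℂ] E, ∀ x, f (B (f x)) = f x := by
  obtain ⟨D, hD⟩ := exists_innerInverse_of_finiteDimensional_range _ h
  refine ⟨P + (ContinuousLinearMap.id ℂ E - P.comp f).comp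
    (D.comp (ContinuousLinearMap.id ℂ F - f.comp P)), fun x => ?_⟩
  have := hD x
  simp only [sub_apply, ContinuousLinearMap.comp_apply, map_sub,
    add_apply, ContinuousLinearMap.id_apply, map_add] at this ⊢
  rw [this]
  abel

theorem closedComplemented_ker_of_innerInverse (f : E →L[ℂ] F) (B : F →L[ℂ] E)
    (h : ∀ x, f (B (f x)) = f x) : (LinearMap.ker (f : E →ₗ[ℂ] F)).ClosedComplemented := by
  refine ⟨(ContinuousLinearMap.id ℂ E - B.comp f).codRestrict _ fun x => ?_, fun x => ?_⟩
  · simp [h]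
  · have hx : f x = 0 := x.2
    exact Subtype.ext (by simp [hx])

theorem closedComplemented_range_of_innerInverse (f : E →L[ℂ] F) (B : F →L[ℂ] E)
    (h : ∀ x, f (B (f x)) = f x) : (LinearMap.range (f : E →ₗ[ℂ] F)).ClosedComplemented := by
  refine ⟨(f.comp B).codRestrict _ fun y => ⟨B y, rfl⟩, ?_⟩
  rintro ⟨_, x, rfl⟩
  exact Subtype.ext (h x)

theorem finiteDimensional_range_of_comp_eq_zero {G : Type*} [NormedAddCommGroup G] [NormedSpace ℂ G]
    (f : E →L[ℂ] F) (g : F →L[ℂ] G) (h : ∀ x, g (f x) = 0)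
    (hf : FiniteDimensional ℂ (F ⧸ LinearMap.range (f : E →ₗ[ℂ] F))) :
    FiniteDimensional ℂ (LinearMap.range (g : F →ₗ[ℂ] G)) := by
  have hle : LinearMap.range (f : E →ₗ[ℂ] F) ≤ LinearMap.ker (g : F →ₗ[ℂ] G) := by
    rintro _ ⟨x, rfl⟩
    exact h x
  rw [← Submodule.range_liftQ _ (g : F →ₗ[ℂ] G) hle]
  infer_instance

/-- The range of `f` has finite codimension and its null space is complemented exactly if `f` has a
right inverse modulo finite rank. -/
theorem split_lowerFredholm_iff [CompleteSpace E] [CompleteSpace F] (f : E →L[ℂ] F) :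
    (FiniteDimensional ℂ (F ⧸ LinearMap.range (f : E →ₗ[ℂ] F)) ∧
      (LinearMap.ker (f : E →ₗ[ℂ] F)).ClosedComplemented) ↔
    ∃ K : F →L[ℂ] E, FiniteDimensional ℂ (LinearMap.range
      ((ContinuousLinearMap.id ℂ F - f.comp K : F →L[ℂ] F) : F →ₗ[ℂ] F)) := by
  constructor
  · rintro ⟨hr, hk⟩
    obtain ⟨B, hB⟩ := exists_innerInverse_of_closedComplemented f hk
      (.of_finiteDimensional_quotient (isClosed_range_of_finiteDimensional_quotient f hr))
    exact ⟨B, finiteDimensional_range_of_comp_eq_zero f _ (fun x => by simp [hB]) hr⟩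
  · rintro ⟨K, hK⟩
    refine ⟨finiteDimensional_quotient_of_coprod_surjective f (LinearMap.range
      ((ContinuousLinearMap.id ℂ F - f.comp K : F →L[ℂ] F) : F →ₗ[ℂ] F)).subtype
        fun y => ⟨⟨_, y, rfl⟩, K y, (sub_add_cancel y (f (K y))).symm⟩, ?_⟩
    obtain ⟨B, hB⟩ := exists_innerInverse_of_sub f K (by
      refine Submodule.finiteDimensional_of_le (S₂ := LinearMap.range
        ((ContinuousLinearMap.id ℂ F - f.comp K : F →L[ℂ] F) : F →ₗ[ℂ] F)) ?_
      rintro _ ⟨x, rfl⟩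
      exact ⟨f x, rfl⟩)
    exact closedComplemented_ker_of_innerInverse f B hB

/-- The null space of `f` has finite dimension and its range is complemented exactly if `f` has a left
inverse modulo finite rank. -/
theorem split_upperFredholm_iff [CompleteSpace E] [CompleteSpace F] (f : E →L[ℂ] F) :
    (FiniteDimensional ℂ (LinearMap.ker (f : E →ₗ[ℂ] F)) ∧
      (LinearMap.range (f : E →ₗ[ℂ] F)).ClosedComplemented) ↔
    ∃ K : F →L[ℂ] E, FiniteDimensional ℂ (LinearMap.range
      ((ContinuousLinearMap.id ℂ E - K.comp f : E →L[ℂ] E) : E →ₗ[ℂ] E)) := by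
  constructor
  · rintro ⟨hk, hr⟩
    obtain ⟨B, hB⟩ := exists_innerInverse_of_closedComplemented f
      (.of_finiteDimensional _) hr
    refine ⟨B, Submodule.finiteDimensional_of_le (S₂ := LinearMap.ker (f : E →ₗ[ℂ] F)) ?_⟩
    rintro _ ⟨x, rfl⟩
    simp [hB]
  · rintro ⟨K, hK⟩
    constructor
    · refine Submodule.finiteDimensional_of_le (S₂ := LinearMap.range
        ((ContinuousLinearMap.id ℂ E - K.comp f : E →L[ℂ] E) : E →ₗ[ℂ] E)) fun x hx => ⟨x, ?_⟩
      have hx' : f x = 0 := hx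
      simp [hx']
    · obtain ⟨B, hB⟩ := exists_innerInverse_of_sub f K (by
        have e : f - f.comp (K.comp f) = f.comp (ContinuousLinearMap.id ℂ E - K.comp f) := by
          ext; simp
        rw [e, ContinuousLinearMap.toLinearMap_comp, LinearMap.range_comp]
        infer_instance)
      exact closedComplemented_range_of_innerInverse f B hB

theorem split_surjective_iff [CompleteSpace E] [CompleteSpace F] (f : E →L[ℂ] F) :
    (Function.Surjective f ∧ (LinearMap.ker (f : E →ₗ[ℂ] F)).ClosedComplemented) ↔
    ∃ K : F →L[ℂ] E, ContinuousLinearMap.id ℂ F - f.comp K = 0 := by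
  constructor
  · rintro ⟨hs, hk⟩
    obtain ⟨B, hB⟩ := exists_innerInverse_of_closedComplemented f hk
      (by rw [LinearMap.range_eq_top.2 hs]; exact Submodule.closedComplemented_top)
    refine ⟨B, ContinuousLinearMap.ext fun y => ?_⟩
    obtain ⟨x, rfl⟩ := hs y
    simp [hB]
  · rintro ⟨K, hK⟩
    have h : Function.RightInverse K f := fun y =>
      (sub_eq_zero.1 (DFunLike.congr_fun hK y)).symm
    exact ⟨h.surjective, f.closedComplemented_ker_of_rightInverse K h⟩

theorem split_injective_iff [CompleteSpace E] [CompleteSpace F] (f : E →L[ℂ] F) :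
    (LinearMap.ker (f : E →ₗ[ℂ] F) = ⊥ ∧
      (LinearMap.range (f : E →ₗ[ℂ] F)).ClosedComplemented) ↔
    ∃ K : F →L[ℂ] E, ContinuousLinearMap.id ℂ E - K.comp f = 0 := by
  constructor
  · rintro ⟨hk, hr⟩
    obtain ⟨B, hB⟩ := exists_innerInverse_of_closedComplemented f
      (by rw [hk]; exact Submodule.closedComplemented_bot) hr
    refine ⟨B, ContinuousLinearMap.ext fun x => ?_⟩
    have := LinearMap.ker_eq_bot.1 hk (hB x)
    simp [this]
  · rintro ⟨K, hK⟩
    have h : Function.LeftInverse K f := fun y =>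
      (sub_eq_zero.1 (DFunLike.congr_fun hK y)).symm
    exact ⟨LinearMap.ker_eq_bot.2 h.injective, f.closedComplemented_range_of_leftInverse K h⟩

end BanachSpaces

/-! ### Tuples of operators -/

section Tuples

variable {X : Type*} [NormedAddCommGroup X] [NormedSpace ℂ X] {n : ℕ}

theorem tupleHat_apply (T : Fin n → X →L[ℂ] X) (x : Fin n → X) :
    tupleHat T x = ∑ i, T i (x i) := by
  simp [tupleHat]

theorem tupleTilde_apply (T : Fin n → X →L[ℂ] X) (x : X) (i : Fin n) :
    tupleTilde T x i = T i x := rfl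

theorem norm_apply_le_tupleTilde (T : Fin n → X →L[ℂ] X) (x : X) (i : Fin n) :
    ‖T i x‖ ≤ ‖tupleTilde T x‖ :=
  norm_le_pi_norm (tupleTilde T x) i

theorem tupleRangeSum_eq_range (T : Fin n → X →L[ℂ] X) :
    tupleRangeSum T = LinearMap.range (tupleHat T : (Fin n → X) →ₗ[ℂ] X) := by
  refine le_antisymm (iSup_le fun i => ?_) ?_
  · rintro _ ⟨x, rfl⟩
    refine ⟨Pi.single i x, ?_⟩
    have : ∀ j, T j (Pi.single (M := fun _ => X) i x j) = if j = i then T i x else 0 := by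
      intro j
      rcases eq_or_ne j i with rfl | h
      · simp
      · simp [h]
    simp [tupleHat_apply, this]
  · rintro _ ⟨x, rfl⟩
    rw [ContinuousLinearMap.coe_coe, tupleHat_apply]
    exact Submodule.sum_mem _ fun i _ => Submodule.mem_iSup_of_mem i ⟨x i, rfl⟩

theorem tupleRangeSum_eq_top_iff (T : Fin n → X →L[ℂ] X) :
    tupleRangeSum T = ⊤ ↔ Function.Surjective (tupleHat T) := by
  rw [tupleRangeSum_eq_range]
  exact LinearMap.range_eq_top

theorem norm_comp_le_tupleHat (T : Fin n → X →L[ℂ] X) (u : X →L[ℂ] ℂ) (i : Fin n) :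
    ‖u.comp (T i)‖ ≤ ‖u.comp (tupleHat T)‖ := by
  refine ContinuousLinearMap.opNorm_le_bound _ (norm_nonneg _) fun x => ?_
  have h := (u.comp (tupleHat T)).le_opNorm (Pi.single i x)
  have : ∀ j, T j (Pi.single (M := fun _ => X) i x j) = if j = i then T i x else 0 := by
    intro j
    rcases eq_or_ne j i with rfl | h
    · simp
    · simp [h]
  simpa [tupleHat_apply, this, Pi.norm_single] using h

end Tuples

/-! ### The operator ideal as a Banach space of operators -/

namespace OperatorIdeal

variable {X₂ X₁ : Type*} [NormedAddCommGroup X₂] [NormedSpace ℂ X₂]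
  [NormedAddCommGroup X₁] [NormedSpace ℂ X₁]

/-- The ideal norm dominates the operator norm: sandwich `A` between rank one operators and use that
`α` is a cross norm on these. -/
theorem norm_coe_le (J : OperatorIdeal X₂ X₁) (A : J.carrier) : ‖(A : X₂ →L[ℂ] X₁)‖ ≤ J.α A := by
  refine ContinuousLinearMap.opNorm_le_bound _ (apply_nonneg _ _) fun x => ?_
  rcases eq_or_ne (A.1 x) 0 with hy | hy
  · rw [hy, norm_zero]
    exact mul_nonneg (apply_nonneg _ _) (norm_nonneg _)
  have hx : x ≠ 0 := by
    rintro rfl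
    exact hy (map_zero _)
  obtain ⟨v, hv, hvy⟩ := exists_dual_vector ℂ (A.1 x) (norm_ne_zero_iff.2 hy)
  obtain ⟨u, hu, -⟩ := exists_dual_vector ℂ x (norm_ne_zero_iff.2 hx)
  have h := J.α_comp_le (v.smulRight (A.1 x)) (u.smulRight x) A
  have e : (⟨_, J.comp_mem (v.smulRight (A.1 x)) (u.smulRight x) A⟩ : J.carrier) =
      ⟨u.smulRight ((‖A.1 x‖ : ℂ) • A.1 x), J.rankOne_mem _ _⟩ := by
    refine Subtype.ext (ContinuousLinearMap.ext fun z => ?_)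
    have hvy' : v (A.1 x) = (‖A.1 x‖ : ℂ) := hvy
    simp [hvy']
  rw [e, J.α_rankOne, norm_smul, Complex.norm_real, norm_norm,
    ContinuousLinearMap.norm_smulRight_apply, ContinuousLinearMap.norm_smulRight_apply, hu, hv] at h
  have hy' : 0 < ‖A.1 x‖ := norm_pos_iff.2 hy
  nlinarith

/-- The inclusion of the operator ideal, with its own norm, into the bounded operators. -/
noncomputable def toCLM (J : OperatorIdeal X₂ X₁) : J.Space →L[ℂ] (X₂ →L[ℂ] X₁) :=
  LinearMap.mkContinuous (J.carrier.subtype : J.Space →ₗ[ℂ] (X₂ →L[ℂ] X₁)) 1 fun A => by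
    rw [one_mul]
    exact J.norm_coe_le A

theorem toCLM_injective (J : OperatorIdeal X₂ X₁) : Function.Injective J.toCLM :=
  Subtype.val_injective

theorem norm_toCLM_apply_le (J : OperatorIdeal X₂ X₁) (A : J.Space) (x : X₂) :
    ‖J.toCLM A x‖ ≤ ‖A‖ * ‖x‖ :=
  (J.toCLM A).le_of_opNorm_le (J.norm_coe_le A) x

theorem toCLM_mul (J : OperatorIdeal X₂ X₁) (S : X₁ →L[ℂ] X₁) (T : X₂ →L[ℂ] X₂) (A : J.Space)
    (x : X₂) : J.toCLM (J.mul S T A) x = S (J.toCLM A (T x)) := rfl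

/-- The rank one operator `x ⊗ u`, as an element of the ideal depending bilinearly on `x` and
`u`. -/
noncomputable def rankOne (J : OperatorIdeal X₂ X₁) : X₁ →L[ℂ] (X₂ →L[ℂ] ℂ) →L[ℂ] J.Space :=
  LinearMap.mkContinuous₂ (LinearMap.mk₂ ℂ
    (fun x u => ((⟨u.smulRight x, J.rankOne_mem x u⟩ : J.carrier) : J.Space))
    (fun x y u => J.toCLM_injective (ContinuousLinearMap.ext fun z => smul_add (u z) x y))
    (fun c x u => J.toCLM_injective (ContinuousLinearMap.ext fun z => smul_comm (u z) c x))
    (fun x u v => J.toCLM_injective (ContinuousLinearMap.ext fun z => add_smul (u z) (v z) x))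
    (fun c x u => J.toCLM_injective (ContinuousLinearMap.ext fun z => mul_smul c (u z) x))) 1
    fun x u => by
      rw [one_mul]
      exact (J.α_rankOne x u).le

theorem toCLM_rankOne (J : OperatorIdeal X₂ X₁) (x : X₁) (u : X₂ →L[ℂ] ℂ) (z : X₂) :
    J.toCLM (J.rankOne x u) z = u z • x := rfl

theorem norm_rankOne (J : OperatorIdeal X₂ X₁) (x : X₁) (u : X₂ →L[ℂ] ℂ) :
    ‖J.rankOne x u‖ = ‖x‖ * ‖u‖ :=
  J.α_rankOne x u

theorem leftMul_rankOne (J : OperatorIdeal X₂ X₁) (S : X₁ →L[ℂ] X₁) (x : X₁) (u : X₂ →L[ℂ] ℂ) :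
    J.leftMul S (J.rankOne x u) = J.rankOne (S x) u :=
  J.toCLM_injective (ContinuousLinearMap.ext fun z => map_smul S (u z) x)

theorem rightMul_rankOne (J : OperatorIdeal X₂ X₁) (T : X₂ →L[ℂ] X₂) (x : X₁) (u : X₂ →L[ℂ] ℂ) :
    J.rightMul T (J.rankOne x u) = J.rankOne x (u.comp T) := rfl

/-- If `S` and `T` have finite rank, then so has `A ↦ S A T`: the product `S A T` depends only on the
operator that `A` induces from the range of `T` to the range of `S`. -/
theorem finiteDimensional_range_mul (J : OperatorIdeal X₂ X₁) (S : X₁ →L[ℂ] X₁) (T : X₂ →L[ℂ] X₂)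
    (hS : FiniteDimensional ℂ (LinearMap.range (S : X₁ →ₗ[ℂ] X₁)))
    (hT : FiniteDimensional ℂ (LinearMap.range (T : X₂ →ₗ[ℂ] X₂))) :
    FiniteDimensional ℂ (LinearMap.range (J.mul S T : J.Space →ₗ[ℂ] J.Space)) := by
  let Ψ : J.Space →ₗ[ℂ]
      (LinearMap.range (T : X₂ →ₗ[ℂ] X₂) →ₗ[ℂ] LinearMap.range (S : X₁ →ₗ[ℂ] X₁)) :=
    { toFun := fun A => (S : X₁ →ₗ[ℂ] X₁).rangeRestrict ∘ₗ (J.toCLM A : X₂ →ₗ[ℂ] X₁) ∘ₗ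
        (LinearMap.range (T : X₂ →ₗ[ℂ] X₂)).subtype
      map_add' := fun A B => by ext; simp
      map_smul' := fun c A => by ext; simp }
  have hle : LinearMap.ker Ψ ≤ LinearMap.ker (J.mul S T : J.Space →ₗ[ℂ] J.Space) := by
    intro A hA
    refine J.toCLM_injective (ContinuousLinearMap.ext fun x => ?_)
    exact congrArg Subtype.val (LinearMap.congr_fun hA ⟨T x, x, rfl⟩)
  have : FiniteDimensional ℂ (J.Space ⧸ LinearMap.ker Ψ) :=
    Module.Finite.equiv Ψ.quotKerEquivRange.symm
  rw [← Submodule.range_liftQ _ _ hle]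
  infer_instance

theorem finiteDimensional_range_mul_of_cases (J : OperatorIdeal X₂ X₁) (E : X₁ →L[ℂ] X₁)
    (F : X₂ →L[ℂ] X₂)
    (h : E = 0 ∨ F = 0 ∨ (FiniteDimensional ℂ (LinearMap.range (E : X₁ →ₗ[ℂ] X₁)) ∧
      FiniteDimensional ℂ (LinearMap.range (F : X₂ →ₗ[ℂ] X₂)))) :
    FiniteDimensional ℂ (LinearMap.range (J.mul E F : J.Space →ₗ[ℂ] J.Space)) := by
  have hz : J.mul E F = 0 →
      FiniteDimensional ℂ (LinearMap.range (J.mul E F : J.Space →ₗ[ℂ] J.Space)) := by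
    intro h0
    rw [h0, ContinuousLinearMap.toLinearMap_zero, LinearMap.range_zero]
    infer_instance
  rcases h with rfl | rfl | ⟨hE, hF⟩
  · exact hz (ContinuousLinearMap.ext fun A => J.toCLM_injective (ContinuousLinearMap.ext
      fun x => rfl))
  · exact hz (ContinuousLinearMap.ext fun A => J.toCLM_injective (ContinuousLinearMap.ext
      fun x => (map_zero (J.toCLM A) ▸ map_zero E : E (J.toCLM A 0) = 0)))
  · exact J.finiteDimensional_range_mul E F hE hF

variable {n m : ℕ}

theorem tupleShift_mulTuple (J : OperatorIdeal X₂ X₁) (S : Fin n → X₁ →L[ℂ] X₁)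
    (T : Fin m → X₂ →L[ℂ] X₂) (a : Fin n → ℂ) (b : Fin m → ℂ) :
    tupleShift (J.mulTuple S T) (Fin.append a b) =
      J.mulTuple (tupleShift S a) (tupleShift T b) := by
  funext k
  refine ContinuousLinearMap.ext fun A => J.toCLM_injective (ContinuousLinearMap.ext fun x => ?_)
  refine Fin.addCases (fun i => ?_) (fun j => ?_) k
  · simp [tupleShift, mulTuple, leftMul, toCLM_mul]
  · simp [tupleShift, mulTuple, rightMul, toCLM_mul]

theorem toCLM_tupleHat_mulTuple (J : OperatorIdeal X₂ X₁) (S : Fin n → X₁ →L[ℂ] X₁)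
    (T : Fin m → X₂ →L[ℂ] X₂) (B : Fin (n + m) → J.Space) (x : X₂) :
    J.toCLM (tupleHat (J.mulTuple S T) B) x =
      tupleHat S (fun i => J.toCLM (B (Fin.castAdd m i)) x) +
        ∑ j, J.toCLM (B (Fin.natAdd n j)) (T j x) := by
  rw [tupleHat_apply, tupleHat_apply, Fin.sum_univ_add]
  simp [mulTuple, leftMul, rightMul, toCLM_mul]

/-- On `x ⊗ u` the tuple `(L_S, R_T)` is small as soon as `S̃ x` and the adjoint of `T̂` at `u` are. -/
theorem norm_tupleTilde_mulTuple_rankOne_le (J : OperatorIdeal X₂ X₁) (S : Fin n → X₁ →L[ℂ] X₁)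
    (T : Fin m → X₂ →L[ℂ] X₂) (x : X₁) (u : X₂ →L[ℂ] ℂ) :
    ‖tupleTilde (J.mulTuple S T) (J.rankOne x u)‖ ≤
      ‖tupleTilde S x‖ * ‖u‖ + ‖x‖ * ‖u.comp (tupleHat T)‖ := by
  refine (pi_norm_le_iff_of_nonneg (by positivity)).2 fun k => ?_
  rw [tupleTilde_apply]
  refine Fin.addCases (fun i => ?_) (fun j => ?_) k
  · rw [mulTuple, Fin.append_left, leftMul_rankOne, norm_rankOne]
    refine le_add_of_le_of_nonneg ?_ (by positivity)
    gcongr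
    exact norm_apply_le_tupleTilde S x i
  · rw [mulTuple, Fin.append_right, rightMul_rankOne, norm_rankOne]
    refine le_add_of_nonneg_of_le (by positivity) ?_
    gcongr
    exact norm_comp_le_tupleHat T u j

/-! ### Fredholm properties of the multiplication tuple pass to the factors -/

section Factors

variable [CompleteSpace X₁] [CompleteSpace X₂] (J : OperatorIdeal X₂ X₁)
  (S : Fin n → X₁ →L[ℂ] X₁) (T : Fin m → X₂ →L[ℂ] X₂)

/-- Solve `∑ Sᵢ Bᵢ + ∑ Cⱼ Tⱼ = y ⊗ u` modulo finitely many parameters and evaluate at an approximate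
null vector `x` of `T̃` with `u(x) = 1`: the terms with `Tⱼ` become negligible, and `y` is
approximated by elements of the range of `Ŝ`, uniformly in `y`. -/
theorem lowerSemiFredholm_left (h : LowerSemiFredholm (J.mulTuple S T))
    (hT : LinearMap.ker (tupleTilde T : X₂ →ₗ[ℂ] (Fin m → X₂)) ≠ ⊥ ∨
      ¬ IsClosed (LinearMap.range (tupleTilde T : X₂ →ₗ[ℂ] (Fin m → X₂)) : Set (Fin m → X₂))) :
    LowerSemiFredholm S := by
  rw [LowerSemiFredholm, tupleRangeSum_eq_range] at h ⊢
  obtain ⟨k, ι, C, hC, hdec⟩ := exists_bounded_decomposition _ h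
  -- with this bound, the `m` terms of norm at most `C * ‖y‖ * ‖Tⱼ x‖` add up to at most `‖y‖ / 2`
  obtain ⟨x, hx, hTx⟩ := exists_norm_apply_le (tupleTilde T) hT
    (ε := (2 * (m * C + 1))⁻¹) (by positivity)
  obtain ⟨u, hu, hux⟩ := exists_dual_vector ℂ x (by rw [hx]; exact one_ne_zero)
  rw [hx] at hux
  let ev : (Fin k → ℂ) →L[ℂ] X₁ := (J.toCLM.comp ι).flip x
  have hs : Function.Surjective (ev.coprod (tupleHat S)) := by
    refine surjective_of_approx_preimage _ C fun y => ?_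
    obtain ⟨a, B, hAB, ha, hB⟩ := hdec (J.rankOne y u)
    rw [norm_rankOne, hu, mul_one] at ha hB
    have hBk : ∀ k, ‖B k‖ ≤ C * ‖y‖ := fun k => (norm_le_pi_norm B k).trans hB
    refine ⟨(a, fun i => J.toCLM (B (Fin.castAdd m i)) x), ?_, ?_⟩
    · have e := congrArg (fun A => J.toCLM A x) hAB
      simp only [map_add, add_apply, toCLM_rankOne, toCLM_tupleHat_mulTuple, hux] at e
      have e' : y - ev.coprod (tupleHat S) (a, fun i => J.toCLM (B (Fin.castAdd m i)) x) =
          ∑ j, J.toCLM (B (Fin.natAdd n j)) (T j x) := by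
        rw [ContinuousLinearMap.coprod_apply, sub_eq_iff_eq_add]
        simp only [RCLike.ofReal_one, one_smul] at e
        rw [e]
        simp only [ev, ContinuousLinearMap.flip_apply, ContinuousLinearMap.comp_apply]
        abel
      rw [e']
      calc ‖∑ j, J.toCLM (B (Fin.natAdd n j)) (T j x)‖
          ≤ ∑ _j : Fin m, C * ‖y‖ * (2 * (m * C + 1))⁻¹ := by
            refine norm_sum_le_of_le _ fun j _ => (J.norm_toCLM_apply_le _ _).trans ?_
            gcongr
            · exact hBk _
            · exact (norm_apply_le_tupleTilde T x j).trans hTx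
        _ = (m * C) / (m * C + 1) * (1 / 2 * ‖y‖) := by
            rw [Finset.sum_const, Finset.card_univ, Fintype.card_fin, nsmul_eq_mul, mul_inv]
            ring
        _ ≤ 1 / 2 * ‖y‖ := by
            refine mul_le_of_le_one_left (by positivity) ?_
            rw [div_le_one (by positivity)]
            linarith
    · refine max_le ha ((pi_norm_le_iff_of_nonneg (by positivity)).2 fun i => ?_)
      refine (J.norm_toCLM_apply_le _ _).trans ?_
      rw [hx, mul_one]
      exact hBk _
  refine finiteDimensional_quotient_of_coprod_surjective (tupleHat S) (ev : (Fin k → ℂ) →ₗ[ℂ] X₁) fun y => ?_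
  obtain ⟨⟨a, z⟩, hz⟩ := hs y
  exact ⟨a, z, hz.symm⟩

/-- Solve `∑ Sᵢ Bᵢ + ∑ Cⱼ Tⱼ = y ⊗ u` modulo finitely many parameters, evaluate at `x` and apply a
functional `v` almost annihilating the range of `Ŝ`: the terms with `Sᵢ` become negligible, and
with `u` norming `x` this bounds `‖x‖` by `‖T̃ x‖` and a finite-rank term. -/
theorem upperSemiFredholm_of_lowerSemiFredholm_mulTuple (h : LowerSemiFredholm (J.mulTuple S T))
    (hS : tupleRangeSum S ≠ ⊤) : UpperSemiFredholm T := by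
  rw [LowerSemiFredholm, tupleRangeSum_eq_range] at h
  rw [Ne, tupleRangeSum_eq_top_iff] at hS
  obtain ⟨k, ι, C, hC, hdec⟩ := exists_bounded_decomposition _ h
  -- the terms with `Sᵢ` then cost `‖x‖ / 4`, to be absorbed into the lower bound `‖x‖ / 2` below
  obtain ⟨v, hv, hvS⟩ := exists_dual_comp_norm_le (tupleHat S) hS
    (ε := (4 * C)⁻¹) (by positivity)
  obtain ⟨y, hy, hvy⟩ := v.exists_lt_apply_of_lt_opNorm (r := 1 / 2) (by rw [hv]; norm_num)
  let g : X₂ →L[ℂ] ((Fin k → ℂ) →L[ℂ] ℂ) :=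
    (ContinuousLinearMap.compL ℂ (Fin k → ℂ) X₁ ℂ v).comp (J.toCLM.comp ι).flip
  refine upperSemiFredholm_of_bound (tupleTilde T) g (c := (4 * C * (m + 1))⁻¹) (by positivity)
    fun x => ?_
  obtain ⟨u, hu, hux⟩ := exists_dual_vector'' ℂ x
  obtain ⟨a, B, hAB, ha, hB⟩ := hdec (J.rankOne y u)
  have hle : ‖y‖ * ‖u‖ ≤ 1 := mul_le_one₀ hy.le (norm_nonneg _) hu
  rw [norm_rankOne] at ha hB
  replace ha : ‖a‖ ≤ C := ha.trans (mul_le_of_le_one_right hC.le hle)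
  replace hB : ‖B‖ ≤ C := hB.trans (mul_le_of_le_one_right hC.le hle)
  have hBk : ∀ k, ‖B k‖ ≤ C := fun k => (norm_le_pi_norm B k).trans hB
  have e := congrArg (fun A => v (J.toCLM A x)) hAB
  simp only [map_add, add_apply, toCLM_rankOne, toCLM_tupleHat_mulTuple, hux, map_smul,
    smul_eq_mul] at e
  have h1 : ‖v (J.toCLM (ι a) x)‖ ≤ C * ‖g x‖ := by
    refine ((g x).le_opNorm a).trans ?_
    rw [mul_comm]
    gcongr
  have h2 : ‖v (tupleHat S fun i => J.toCLM (B (Fin.castAdd m i)) x)‖ ≤ 1 / 4 * ‖x‖ := by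
    refine ((v.comp (tupleHat S)).le_opNorm _).trans ?_
    calc _ ≤ (4 * C)⁻¹ * (C * ‖x‖) := by
          gcongr
          refine (pi_norm_le_iff_of_nonneg (by positivity)).2 fun i => ?_
          refine (J.norm_toCLM_apply_le _ _).trans ?_
          gcongr
          exact hBk _
      _ = 1 / 4 * ‖x‖ := by field_simp
  have h3 : ‖v (∑ j, J.toCLM (B (Fin.natAdd n j)) (T j x))‖ ≤ m * (C * ‖tupleTilde T x‖) := by
    refine (v.le_opNorm _).trans ?_
    rw [hv, one_mul]
    calc _ ≤ ∑ _j : Fin m, C * ‖tupleTilde T x‖ := by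
          refine norm_sum_le_of_le _ fun j _ => (J.norm_toCLM_apply_le _ _).trans ?_
          gcongr
          · exact hBk _
          · exact norm_apply_le_tupleTilde T x j
      _ = m * (C * ‖tupleTilde T x‖) := by simp
  have h4 : 1 / 2 * ‖x‖ ≤ C * ‖g x‖ + (1 / 4 * ‖x‖ + m * (C * ‖tupleTilde T x‖)) := by
    calc 1 / 2 * ‖x‖ ≤ ‖v y‖ * ‖x‖ := by gcongr
      _ = ‖(‖x‖ : ℂ) * v y‖ := by rw [norm_mul, Complex.norm_real, norm_norm, mul_comm]
      _ ≤ _ := by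
          refine (congrArg norm e).trans_le ?_
          exact (norm_add_le _ _).trans (add_le_add h1 ((norm_add_le _ _).trans (add_le_add h2 h3)))
  rw [inv_mul_le_iff₀ (by positivity)]
  have h5 : 0 ≤ C * ‖tupleTilde T x‖ := by positivity
  have h6 : 0 ≤ m * (C * ‖g x‖) := by positivity
  linarith

theorem upperSemiFredholm_left (h : UpperSemiFredholm (J.mulTuple S T))
    (hT : tupleRangeSum T ≠ ⊤) : UpperSemiFredholm S := by
  rw [Ne, tupleRangeSum_eq_top_iff] at hT
  have := h.1
  obtain ⟨g, c, hc, hg⟩ := exists_bound_of_upperSemiFredholm _ h.1 h.2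
  obtain ⟨v, hv, hvT⟩ := exists_dual_comp_norm_le (tupleHat T) hT (half_pos hc)
  refine upperSemiFredholm_of_bound (tupleTilde S) (g.comp (J.rankOne.flip v)) (half_pos hc)
    fun y => ?_
  have h1 := hg (J.rankOne y v)
  have h2 := J.norm_tupleTilde_mulTuple_rankOne_le S T y v
  have h3 := mul_le_mul_of_nonneg_left hvT (norm_nonneg y)
  rw [norm_rankOne] at h1
  rw [hv, mul_one] at h1 h2
  rw [ContinuousLinearMap.comp_apply, ContinuousLinearMap.flip_apply]
  linarith

theorem lowerSemiFredholm_of_upperSemiFredholm_mulTuple (h : UpperSemiFredholm (J.mulTuple S T))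
    (hS : LinearMap.ker (tupleTilde S : X₁ →ₗ[ℂ] (Fin n → X₁)) ≠ ⊥ ∨
      ¬ IsClosed (LinearMap.range (tupleTilde S : X₁ →ₗ[ℂ] (Fin n → X₁)) : Set (Fin n → X₁))) :
    LowerSemiFredholm T := by
  rw [LowerSemiFredholm, tupleRangeSum_eq_range]
  have := h.1
  obtain ⟨g, c, hc, hg⟩ := exists_bound_of_upperSemiFredholm _ h.1 h.2
  obtain ⟨x, hx, hSx⟩ := exists_norm_apply_le (tupleTilde S) hS (half_pos hc)
  refine finiteDimensional_quotient_of_dual_bound (tupleHat T) (g.comp (J.rankOne x)) (half_pos hc)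
    fun u => ?_
  have h1 := hg (J.rankOne x u)
  have h2 := J.norm_tupleTilde_mulTuple_rankOne_le S T x u
  have h3 := mul_le_mul_of_nonneg_right hSx (norm_nonneg u)
  rw [norm_rankOne] at h1
  rw [hx, one_mul] at h1 h2
  rw [ContinuousLinearMap.comp_apply]
  linarith

end Factors

/-! ### Parametrices for the multiplication tuple -/

section Parametrix

variable (J : OperatorIdeal X₂ X₁) (S : Fin n → X₁ →L[ℂ] X₁) (T : Fin m → X₂ →L[ℂ] X₂)

/-- If `E = 1 - Ŝ K` and `F = 1 - P T̃`, then `A ↦ (Kᵢ A, E A Pⱼ)` is a right inverse of the row of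
`(L_S, R_T)` modulo `A ↦ E A F`. -/
theorem exists_rightParametrix_mulTuple (K : X₁ →L[ℂ] (Fin n → X₁)) (P : (Fin m → X₂) →L[ℂ] X₂) :
    ∃ R : J.Space →L[ℂ] (Fin (n + m) → J.Space),
      ContinuousLinearMap.id ℂ J.Space - (tupleHat (J.mulTuple S T)).comp R =
        J.mul (ContinuousLinearMap.id ℂ X₁ - (tupleHat S).comp K)
          (ContinuousLinearMap.id ℂ X₂ - P.comp (tupleTilde T)) := by
  refine ⟨ContinuousLinearMap.pi (Fin.append
    (fun i => J.leftMul ((ContinuousLinearMap.proj i).comp K))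
    (fun j => J.mul (ContinuousLinearMap.id ℂ X₁ - (tupleHat S).comp K)
      (P.comp (ContinuousLinearMap.single ℂ (fun _ : Fin m => X₂) j)))), ?_⟩
  refine ContinuousLinearMap.ext fun A => J.toCLM_injective (ContinuousLinearMap.ext fun x => ?_)
  have hsum : ∑ j, J.toCLM A (P (Pi.single j (T j x))) = J.toCLM A (P (tupleTilde T x)) := by
    rw [← map_sum, ← map_sum]
    congr 2
    exact Finset.univ_sum_single (tupleTilde T x)
  rw [toCLM_mul, sub_apply, map_sub, sub_apply, ContinuousLinearMap.comp_apply,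
    toCLM_tupleHat_mulTuple]
  simp only [ContinuousLinearMap.pi_apply, Fin.append_left, Fin.append_right, leftMul, toCLM_mul,
    ContinuousLinearMap.comp_apply, ContinuousLinearMap.single_apply, ContinuousLinearMap.id_apply]
  rw [← map_sum, hsum]
  have e : (fun i => (ContinuousLinearMap.proj (R := ℂ) (φ := fun _ : Fin n => X₁) i)
      (K (J.toCLM A x))) = K (J.toCLM A x) := rfl
  simp only [e, sub_apply, map_sub, ContinuousLinearMap.comp_apply, ContinuousLinearMap.id_apply]
  abel

/-- If `E = 1 - P S̃` and `F = 1 - T̂ K`, then `(Aᵢ, Bⱼ) ↦ ∑ Pᵢ Aᵢ + ∑ E Bⱼ Kⱼ` is a left inverse of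
the column of `(L_S, R_T)` modulo `A ↦ E A F`. -/
theorem exists_leftParametrix_mulTuple (P : (Fin n → X₁) →L[ℂ] X₁) (K : X₂ →L[ℂ] (Fin m → X₂)) :
    ∃ R : (Fin (n + m) → J.Space) →L[ℂ] J.Space,
      ContinuousLinearMap.id ℂ J.Space - R.comp (tupleTilde (J.mulTuple S T)) =
        J.mul (ContinuousLinearMap.id ℂ X₁ - P.comp (tupleTilde S))
          (ContinuousLinearMap.id ℂ X₂ - (tupleHat T).comp K) := by
  refine ⟨∑ i, (J.leftMul (P.comp (ContinuousLinearMap.single ℂ (fun _ : Fin n => X₁) i))).comp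
      (ContinuousLinearMap.proj (Fin.castAdd m i)) +
    ∑ j, (J.mul (ContinuousLinearMap.id ℂ X₁ - P.comp (tupleTilde S))
      ((ContinuousLinearMap.proj j).comp K)).comp (ContinuousLinearMap.proj (Fin.natAdd n j)), ?_⟩
  refine ContinuousLinearMap.ext fun A => J.toCLM_injective (ContinuousLinearMap.ext fun x => ?_)
  have hsum : ∀ y, ∑ i, P (Pi.single i (S i y)) = P (tupleTilde S y) := by
    intro y
    rw [← map_sum]
    congr 1
    exact Finset.univ_sum_single (tupleTilde S y)
  have hsum' : ∑ j, J.toCLM A (T j (K x j)) = J.toCLM A (tupleHat T (K x)) := by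
    rw [tupleHat_apply, map_sum]
  rw [toCLM_mul, sub_apply, map_sub, sub_apply, ContinuousLinearMap.comp_apply, add_apply, map_add,
    add_apply, sum_apply, sum_apply, map_sum, map_sum,
    sum_apply, sum_apply]
  simp only [ContinuousLinearMap.comp_apply, ContinuousLinearMap.proj_apply, tupleTilde_apply,
    mulTuple, Fin.append_left, Fin.append_right, leftMul, rightMul, toCLM_mul,
    ContinuousLinearMap.single_apply, ContinuousLinearMap.id_apply]
  rw [hsum, ← map_sum, hsum']
  simp only [sub_apply, map_sub, ContinuousLinearMap.comp_apply, ContinuousLinearMap.id_apply]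
  abel

end Parametrix

end OperatorIdeal

/-! ### Hilbert spaces -/

section Hilbert

variable {X : Type*} [NormedAddCommGroup X] [inst : NormedSpace ℂ X] [CompleteSpace X] {n : ℕ}

/-- The supremum norm of `Xⁿ` is equivalent to the Hilbert space norm, so orthogonal projections are
available. -/
theorem HasInnerProductNorm.closedComplemented (h : HasInnerProductNorm X)
    (p : Submodule ℂ (Fin n → X)) (hp : IsClosed (p : Set (Fin n → X))) : p.ClosedComplemented := by
  obtain ⟨i, rfl⟩ := h
  let e := PiLp.continuousLinearEquiv 2 ℂ (fun _ : Fin n => X)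
  let q : Submodule ℂ (PiLp 2 fun _ : Fin n => X) := p.comap e.toLinearEquiv.toLinearMap
  have hq : IsClosed (q : Set (PiLp 2 fun _ : Fin n => X)) := hp.preimage e.continuous
  have : CompleteSpace q := hq.completeSpace_coe
  refine ⟨((e.toContinuousLinearMap.comp q.starProjection).comp
    e.symm.toContinuousLinearMap).codRestrict p fun x => ?_, fun x => Subtype.ext ?_⟩
  · exact Submodule.starProjection_apply_mem q (e.symm x)
  · have hx : e.symm x ∈ q := by
      change e (e.symm (x : Fin n → X)) ∈ p
      rw [e.apply_symm_apply]
      exact x.2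
    have h1 := Submodule.starProjection_eq_self_iff.2 hx
    change e (q.starProjection (e.symm (x : Fin n → X))) = x
    rw [h1, e.apply_symm_apply]

theorem HasInnerProductNorm.kernelNotSplit_eq_empty (h : HasInnerProductNorm X)
    (T : Fin n → X →L[ℂ] X) : kernelNotSplit T = ∅ :=
  Set.eq_empty_of_forall_notMem fun _ ha =>
    ha (h.closedComplemented _ (ContinuousLinearMap.isClosed_ker _))

theorem HasInnerProductNorm.rangeNotSplit_subset (h : HasInnerProductNorm X)
    (T : Fin n → X →L[ℂ] X) : rangeNotSplit T ⊆ upperFredholmSpectrum T :=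
  fun _ ha hU => ha (h.closedComplemented _ hU.2)

theorem HasInnerProductNorm.rangeNotSplit_subset_approxPointSpectrum (h : HasInnerProductNorm X)
    (T : Fin n → X →L[ℂ] X) : rangeNotSplit T ⊆ approxPointSpectrum T :=
  fun _ ha => Or.inr fun hcl => ha (h.closedComplemented _ hcl)

end Hilbert

/-! ### The split spectra and one-sided parametrices -/

section SplitSpectra

variable {X : Type*} [NormedAddCommGroup X] [NormedSpace ℂ X] [CompleteSpace X] {n : ℕ}

theorem notMem_essSplitDefectSpectrum_iff (T : Fin n → X →L[ℂ] X) (a : Fin n → ℂ) :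
    a ∉ essSplitDefectSpectrum T ↔ ∃ K : X →L[ℂ] (Fin n → X), FiniteDimensional ℂ (LinearMap.range
      ((ContinuousLinearMap.id ℂ X - (tupleHat (tupleShift T a)).comp K : X →L[ℂ] X) :
        X →ₗ[ℂ] X)) := by
  rw [← split_lowerFredholm_iff, ← tupleRangeSum_eq_range]
  simp [essSplitDefectSpectrum, lowerFredholmSpectrum, kernelNotSplit, LowerSemiFredholm]

theorem notMem_splitDefectSpectrum_iff (T : Fin n → X →L[ℂ] X) (a : Fin n → ℂ) :
    a ∉ splitDefectSpectrum T ↔ ∃ K : X →L[ℂ] (Fin n → X),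
      ContinuousLinearMap.id ℂ X - (tupleHat (tupleShift T a)).comp K = 0 := by
  rw [← split_surjective_iff, ← tupleRangeSum_eq_top_iff]
  simp [splitDefectSpectrum, defectSpectrum, kernelNotSplit]

theorem notMem_essSplitApproxPointSpectrum_iff (T : Fin n → X →L[ℂ] X) (a : Fin n → ℂ) :
    a ∉ essSplitApproxPointSpectrum T ↔ ∃ K : (Fin n → X) →L[ℂ] X,
      FiniteDimensional ℂ (LinearMap.range
        ((ContinuousLinearMap.id ℂ X - K.comp (tupleTilde (tupleShift T a)) : X →L[ℂ] X) :
          X →ₗ[ℂ] X)) := by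
  rw [← split_upperFredholm_iff]
  simp only [essSplitApproxPointSpectrum, upperFredholmSpectrum, rangeNotSplit, UpperSemiFredholm,
    Set.mem_union, Set.mem_ofPred_eq, not_or, not_not]
  exact ⟨fun h => ⟨h.1.1, h.2⟩, fun h => ⟨⟨h.1, h.2.isClosed⟩, h.2⟩⟩

theorem notMem_splitApproxPointSpectrum_iff (T : Fin n → X →L[ℂ] X) (a : Fin n → ℂ) :
    a ∉ splitApproxPointSpectrum T ↔ ∃ K : (Fin n → X) →L[ℂ] X,
      ContinuousLinearMap.id ℂ X - K.comp (tupleTilde (tupleShift T a)) = 0 := by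
  rw [← split_injective_iff]
  simp only [splitApproxPointSpectrum, approxPointSpectrum, rangeNotSplit, Set.mem_union,
    Set.mem_ofPred_eq, not_or, not_not, Ne]
  exact ⟨fun h => ⟨h.1.1, h.2⟩, fun h => ⟨⟨h.1, h.2.isClosed⟩, h.2⟩⟩

end SplitSpectra

/-! ### The inclusions between the joint spectra -/

section Product

variable {n m : ℕ}

theorem append_mem_tupleProd {A : Set (Fin n → ℂ)} {B : Set (Fin m → ℂ)} {a : Fin n → ℂ}
    {b : Fin m → ℂ} : Fin.append a b ∈ tupleProd A B ↔ a ∈ A ∧ b ∈ B := by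
  refine ⟨?_, fun h => ⟨a, h.1, b, h.2, rfl⟩⟩
  rintro ⟨a', ha, b', hb, h⟩
  have h₁ : a' = a := funext fun i => by simpa using congrFun h (Fin.castAdd m i)
  have h₂ : b' = b := funext fun j => by simpa using congrFun h (Fin.natAdd n j)
  exact ⟨h₁ ▸ ha, h₂ ▸ hb⟩

theorem exists_eq_append (z : Fin (n + m) → ℂ) : ∃ a b, z = Fin.append a b :=
  ⟨_, _, (Fin.append_castAdd_natAdd (f := z)).symm⟩

end Product

namespace OperatorIdeal

variable {X₂ X₁ : Type*} [NormedAddCommGroup X₂] [NormedSpace ℂ X₂] [CompleteSpace X₂]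
  [NormedAddCommGroup X₁] [NormedSpace ℂ X₁] [CompleteSpace X₁] {n m : ℕ}
  (J : OperatorIdeal X₂ X₁) (S : Fin n → X₁ →L[ℂ] X₁) (T : Fin m → X₂ →L[ℂ] X₂)

theorem tupleProd_subset_lowerFredholmSpectrum :
    tupleProd (lowerFredholmSpectrum S) (approxPointSpectrum T) ∪
        tupleProd (defectSpectrum S) (upperFredholmSpectrum T) ⊆
      lowerFredholmSpectrum (J.mulTuple S T) := by
  rintro _ (⟨a, ha, b, hb, rfl⟩ | ⟨a, ha, b, hb, rfl⟩) h <;> rw [tupleShift_mulTuple] at h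
  · exact ha (J.lowerSemiFredholm_left _ _ h hb)
  · exact hb (J.upperSemiFredholm_of_lowerSemiFredholm_mulTuple _ _ h ha)

theorem tupleProd_subset_upperFredholmSpectrum :
    tupleProd (upperFredholmSpectrum S) (defectSpectrum T) ∪
        tupleProd (approxPointSpectrum S) (lowerFredholmSpectrum T) ⊆
      upperFredholmSpectrum (J.mulTuple S T) := by
  rintro _ (⟨a, ha, b, hb, rfl⟩ | ⟨a, ha, b, hb, rfl⟩) h <;> rw [tupleShift_mulTuple] at h
  · exact ha (J.upperSemiFredholm_left _ _ h hb)
  · exact hb (J.lowerSemiFredholm_of_upperSemiFredholm_mulTuple _ _ h ha)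

/-- Off the right-hand side, either one of the two remainders `1 - Ŝ K` and `1 - P T̃` can be made
zero, or both can be made of finite rank. -/
theorem essSplitDefectSpectrum_subset :
    essSplitDefectSpectrum (J.mulTuple S T) ⊆
      tupleProd (essSplitDefectSpectrum S) (splitApproxPointSpectrum T) ∪
        tupleProd (splitDefectSpectrum S) (essSplitApproxPointSpectrum T) := by
  intro z
  obtain ⟨a, b, rfl⟩ := exists_eq_append z
  contrapose
  rw [Set.mem_union, append_mem_tupleProd, append_mem_tupleProd]
  intro h
  have key : ∃ (K : X₁ →L[ℂ] (Fin n → X₁)) (P : (Fin m → X₂) →L[ℂ] X₂),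
      FiniteDimensional ℂ (LinearMap.range
        (J.mul (ContinuousLinearMap.id ℂ X₁ - (tupleHat (tupleShift S a)).comp K)
          (ContinuousLinearMap.id ℂ X₂ - P.comp (tupleTilde (tupleShift T b))) :
            J.Space →ₗ[ℂ] J.Space)) := by
    by_cases hS : a ∈ splitDefectSpectrum S
    · by_cases hT : b ∈ splitApproxPointSpectrum T
      · have hS' : a ∉ essSplitDefectSpectrum S := fun h' => h (Or.inl ⟨h', hT⟩)
        have hT' : b ∉ essSplitApproxPointSpectrum T := fun h' => h (Or.inr ⟨hS, h'⟩)
        obtain ⟨K, hK⟩ := (notMem_essSplitDefectSpectrum_iff S a).1 hS'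
        obtain ⟨P, hP⟩ := (notMem_essSplitApproxPointSpectrum_iff T b).1 hT'
        exact ⟨K, P, J.finiteDimensional_range_mul_of_cases _ _ (Or.inr (Or.inr ⟨hK, hP⟩))⟩
      · obtain ⟨P, hP⟩ := (notMem_splitApproxPointSpectrum_iff T b).1 hT
        exact ⟨0, P, J.finiteDimensional_range_mul_of_cases _ _ (Or.inr (Or.inl hP))⟩
    · obtain ⟨K, hK⟩ := (notMem_splitDefectSpectrum_iff S a).1 hS
      exact ⟨K, 0, J.finiteDimensional_range_mul_of_cases _ _ (Or.inl hK)⟩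
  obtain ⟨K, P, hKP⟩ := key
  obtain ⟨R, hR⟩ := J.exists_rightParametrix_mulTuple (tupleShift S a) (tupleShift T b) K P
  rw [notMem_essSplitDefectSpectrum_iff, tupleShift_mulTuple]
  exact ⟨R, by rw [hR]; exact hKP⟩

/-- Off the right-hand side, either one of the two remainders `1 - P S̃` and `1 - T̂ K` can be made
zero, or both can be made of finite rank. -/
theorem essSplitApproxPointSpectrum_subset :
    essSplitApproxPointSpectrum (J.mulTuple S T) ⊆
      tupleProd (essSplitApproxPointSpectrum S) (splitDefectSpectrum T) ∪
        tupleProd (splitApproxPointSpectrum S) (essSplitDefectSpectrum T) := by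
  intro z
  obtain ⟨a, b, rfl⟩ := exists_eq_append z
  contrapose
  rw [Set.mem_union, append_mem_tupleProd, append_mem_tupleProd]
  intro h
  have key : ∃ (P : (Fin n → X₁) →L[ℂ] X₁) (K : X₂ →L[ℂ] (Fin m → X₂)),
      FiniteDimensional ℂ (LinearMap.range
        (J.mul (ContinuousLinearMap.id ℂ X₁ - P.comp (tupleTilde (tupleShift S a)))
          (ContinuousLinearMap.id ℂ X₂ - (tupleHat (tupleShift T b)).comp K) :
            J.Space →ₗ[ℂ] J.Space)) := by
    by_cases hS : a ∈ splitApproxPointSpectrum S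
    · by_cases hT : b ∈ splitDefectSpectrum T
      · have hS' : a ∉ essSplitApproxPointSpectrum S := fun h' => h (Or.inl ⟨h', hT⟩)
        have hT' : b ∉ essSplitDefectSpectrum T := fun h' => h (Or.inr ⟨hS, h'⟩)
        obtain ⟨P, hP⟩ := (notMem_essSplitApproxPointSpectrum_iff S a).1 hS'
        obtain ⟨K, hK⟩ := (notMem_essSplitDefectSpectrum_iff T b).1 hT'
        exact ⟨P, K, J.finiteDimensional_range_mul_of_cases _ _ (Or.inr (Or.inr ⟨hP, hK⟩))⟩
      · obtain ⟨K, hK⟩ := (notMem_splitDefectSpectrum_iff T b).1 hT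
        exact ⟨0, K, J.finiteDimensional_range_mul_of_cases _ _ (Or.inr (Or.inl hK))⟩
    · obtain ⟨P, hP⟩ := (notMem_splitApproxPointSpectrum_iff S a).1 hS
      exact ⟨P, 0, J.finiteDimensional_range_mul_of_cases _ _ (Or.inl hP)⟩
  obtain ⟨P, K, hPK⟩ := key
  obtain ⟨R, hR⟩ := J.exists_leftParametrix_mulTuple (tupleShift S a) (tupleShift T b) P K
  rw [notMem_essSplitApproxPointSpectrum_iff, tupleShift_mulTuple]
  exact ⟨R, by rw [hR]; exact hPK⟩

end OperatorIdeal

theorem proposition6p2 {X₁ X₂ : Type*}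
    [NormedAddCommGroup X₁] [NormedSpace ℂ X₁] [CompleteSpace X₁]
    [NormedAddCommGroup X₂] [NormedSpace ℂ X₂] [CompleteSpace X₂]
    (J : OperatorIdeal X₂ X₁) (n m : ℕ)
    (S : Fin n → X₁ →L[ℂ] X₁) (hS : ∀ i j, Commute (S i) (S j))
    (T : Fin m → X₂ →L[ℂ] X₂) (hT : ∀ i j, Commute (T i) (T j)) :
    (tupleProd (lowerFredholmSpectrum S) (approxPointSpectrum T) ∪
          tupleProd (defectSpectrum S) (upperFredholmSpectrum T) ⊆
        lowerFredholmSpectrum (J.mulTuple S T) ∧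
      lowerFredholmSpectrum (J.mulTuple S T) ⊆ essSplitDefectSpectrum (J.mulTuple S T) ∧
      essSplitDefectSpectrum (J.mulTuple S T) ⊆
        tupleProd (essSplitDefectSpectrum S) (splitApproxPointSpectrum T) ∪
          tupleProd (splitDefectSpectrum S) (essSplitApproxPointSpectrum T)) ∧
    (tupleProd (upperFredholmSpectrum S) (defectSpectrum T) ∪
          tupleProd (approxPointSpectrum S) (lowerFredholmSpectrum T) ⊆
        upperFredholmSpectrum (J.mulTuple S T) ∧
      upperFredholmSpectrum (J.mulTuple S T) ⊆ essSplitApproxPointSpectrum (J.mulTuple S T) ∧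
      essSplitApproxPointSpectrum (J.mulTuple S T) ⊆
        tupleProd (essSplitApproxPointSpectrum S) (splitDefectSpectrum T) ∪
          tupleProd (splitApproxPointSpectrum S) (essSplitDefectSpectrum T)) ∧
    (HasInnerProductNorm X₁ → HasInnerProductNorm X₂ →
      (tupleProd (lowerFredholmSpectrum S) (approxPointSpectrum T) ∪
            tupleProd (defectSpectrum S) (upperFredholmSpectrum T) =
          lowerFredholmSpectrum (J.mulTuple S T) ∧
        lowerFredholmSpectrum (J.mulTuple S T) = essSplitDefectSpectrum (J.mulTuple S T) ∧
        essSplitDefectSpectrum (J.mulTuple S T) =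
          tupleProd (essSplitDefectSpectrum S) (splitApproxPointSpectrum T) ∪
            tupleProd (splitDefectSpectrum S) (essSplitApproxPointSpectrum T)) ∧
      (tupleProd (upperFredholmSpectrum S) (defectSpectrum T) ∪
            tupleProd (approxPointSpectrum S) (lowerFredholmSpectrum T) =
          upperFredholmSpectrum (J.mulTuple S T) ∧
        upperFredholmSpectrum (J.mulTuple S T) = essSplitApproxPointSpectrum (J.mulTuple S T) ∧
        essSplitApproxPointSpectrum (J.mulTuple S T) =
          tupleProd (essSplitApproxPointSpectrum S) (splitDefectSpectrum T) ∪
            tupleProd (splitApproxPointSpectrum S) (essSplitDefectSpectrum T))) := by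
  have h₁ := J.tupleProd_subset_lowerFredholmSpectrum S T
  have h₂ : lowerFredholmSpectrum (J.mulTuple S T) ⊆ essSplitDefectSpectrum (J.mulTuple S T) :=
    Set.subset_union_left
  have h₃ := J.essSplitDefectSpectrum_subset S T
  have k₁ := J.tupleProd_subset_upperFredholmSpectrum S T
  have k₂ : upperFredholmSpectrum (J.mulTuple S T) ⊆
      essSplitApproxPointSpectrum (J.mulTuple S T) := Set.subset_union_left
  have k₃ := J.essSplitApproxPointSpectrum_subset S T
  refine ⟨⟨h₁, h₂, h₃⟩, ⟨k₁, k₂, k₃⟩, fun hX₁ hX₂ => ?_⟩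
  -- on a Hilbert space the split spectra are the plain ones, so both chains close up
  have hS₁ : essSplitDefectSpectrum S = lowerFredholmSpectrum S := by
    rw [essSplitDefectSpectrum, hX₁.kernelNotSplit_eq_empty, Set.union_empty]
  have hS₂ : splitDefectSpectrum S = defectSpectrum S := by
    rw [splitDefectSpectrum, hX₁.kernelNotSplit_eq_empty, Set.union_empty]
  have hS₃ : essSplitApproxPointSpectrum S = upperFredholmSpectrum S :=
    Set.union_eq_left.2 (hX₁.rangeNotSplit_subset S)
  have hS₄ : splitApproxPointSpectrum S = approxPointSpectrum S :=
    Set.union_eq_left.2 (hX₁.rangeNotSplit_subset_approxPointSpectrum S)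
  have hT₁ : essSplitDefectSpectrum T = lowerFredholmSpectrum T := by
    rw [essSplitDefectSpectrum, hX₂.kernelNotSplit_eq_empty, Set.union_empty]
  have hT₂ : splitDefectSpectrum T = defectSpectrum T := by
    rw [splitDefectSpectrum, hX₂.kernelNotSplit_eq_empty, Set.union_empty]
  have hT₃ : essSplitApproxPointSpectrum T = upperFredholmSpectrum T :=
    Set.union_eq_left.2 (hX₂.rangeNotSplit_subset T)
  have hT₄ : splitApproxPointSpectrum T = approxPointSpectrum T :=
    Set.union_eq_left.2 (hX₂.rangeNotSplit_subset_approxPointSpectrum T)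
  rw [hS₁, hT₄, hS₂, hT₃] at h₃ ⊢
  rw [hS₃, hT₂, hS₄, hT₁] at k₃ ⊢
  exact ⟨⟨h₁.antisymm (h₂.trans h₃), h₂.antisymm (h₃.trans h₁), h₃.antisymm (h₁.trans h₂)⟩,
    ⟨k₁.antisymm (k₂.trans k₃), k₂.antisymm (k₃.trans k₁), k₃.antisymm (k₁.trans k₂)⟩⟩
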